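/- Let $\mathfrak A$ be an AF $\mathrm C^*$-algebra with a sequence $\mathfrak A_0\subseteq\mathfrak A_1\subseteq\cdots$ of finite-dimensional $\mathrm C^*$-subalgebras with dense union, each $\mathfrak A_n=\bigoplus_r M_{k(n,r)}(\mathbb C)$ equipped with matrix units $e^{(n,r)}_{ij}$ such that every matrix unit of $\mathfrak A_n$ is a sum of matrix units of $\mathfrak A_{n+1}$. Let $\mathcal A\subseteq\mathfrak A$ be a strongly maximal TAF algebra, that is, a norm-closed subalgebra such that, for a suitable such system, $\mathcal A\cap\mathcal A^*$ is the closed span of the diagonal matrix units $e^{(n,r)}_{ii}$, the union of the algebras $\mathcal A\cap\mathfrak A_n$ is dense in $\mathcal A$, and each $\mathcal A\cap\mathfrak A_n$ is the direct sum of the full upper triangular matrix algebras $\operatorname{span}\{e^{(n,r)}_{ij}: i\le j\}$. (Neither $\mathfrak A$ nor $\mathcal A$ is assumed to be unital.) A bounded nest representation of $\mathcal A$ is a bounded algebra homomorphism $\pi:\mathcal A\to\mathcal B(\mathcal H)$, $\mathcal H$ a complex Hilbert space, such that the closed subspaces of $\mathcal H$ invariant under $\pi(\mathcal A)$ are totally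 ordered by inclusion. A closed two-sided ideal $\mathcal J$ of $\mathcal A$ is meet-irreducible if, for all closed two-sided ideals $\mathcal I_1,\mathcal I_2$ of $\mathcal A$ containing $\mathcal J$, $\mathcal I_1\cap\mathcal I_2=\mathcal J$ implies $\mathcal I_1=\mathcal J$ or $\mathcal I_2=\mathcal J$. An ideal is n-primitive if it is the kernel of a bounded nest representation of $\mathcal A$. (1) If $\pi$ is a bounded nest representation of $\mathcal A$ on a Hilbert space, then $\ker\pi$ is a meet-irreducible (closed, two-sided) ideal of $\mathcal A$. (2) Consequently, a two-sided ideal of $\mathcal A$ is n-primitive if and only if it is meet-irreducible. -/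

import Mathlib

/-- A sequence of finite-dimensional C*-subalgebras `𝔄₀ ⊆ 𝔄₁ ⊆ ⋯` with dense union in `𝔄`,
given by compatible matrix units: `𝔄ₙ` is the direct sum over `r : Fin (blocks n)` of the full
matrix algebras of size `size n r`, with matrix units `e n r i j`, and every matrix unit of `𝔄ₙ`
is a sum of matrix units of `𝔄ₙ₊₁`. -/
structure AFSystem (𝔄 : Type*) [NonUnitalCStarAlgebra 𝔄] where
  blocks : ℕ → ℕ
  size : (n : ℕ) → Fin (blocks n) → ℕ
  e : (n : ℕ) → (r : Fin (blocks n)) → Fin (size n r) → Fin (size n r) → 𝔄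
  e_ne_zero : ∀ n r i j, e n r i j ≠ 0
  star_e : ∀ n r i j, star (e n r i j) = e n r j i
  e_mul_e : ∀ n r i j k l, e n r i j * e n r k l = if j = k then e n r i l else 0
  e_mul_e_of_ne : ∀ n r r' i j k l, r ≠ r' → e n r i j * e n r' k l = 0
  refine_e : ∀ n r i j,
    ∃ s : Finset (Σ t : Fin (blocks (n + 1)), Fin (size (n + 1) t) × Fin (size (n + 1) t)),
      e n r i j = ∑ x ∈ s, e (n + 1) x.1 x.2.1 x.2.2
  dense_span : Dense (Submodule.span ℂ {x : 𝔄 | ∃ n r i j, x = e n r i j} : Set 𝔄)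

namespace AFSystem

variable {𝔄 : Type*} [NonUnitalCStarAlgebra 𝔄] (M : AFSystem 𝔄)

/-- The finite-dimensional C*-algebra `𝔄ₙ`. -/
def level (n : ℕ) : Submodule ℂ 𝔄 :=
  Submodule.span ℂ {x | ∃ r i j, x = M.e n r i j}

/-- The direct sum of the full upper triangular matrix algebras of the summands of `𝔄ₙ`. -/
def upper (n : ℕ) : Submodule ℂ 𝔄 :=
  Submodule.span ℂ {x | ∃ r i j, i ≤ j ∧ x = M.e n r i j}

/-- The canonical masa of the system: the closed span of all diagonal matrix units. -/
def masa : Submodule ℂ 𝔄 :=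
  (Submodule.span ℂ {x | ∃ n r i, x = M.e n r i i}).topologicalClosure

end AFSystem

section TAF

variable {𝔄 : Type*} [NonUnitalCStarAlgebra 𝔄]

/-- `A` is a triangular AF algebra with respect to the system `M`: a closed subalgebra whose
diagonal `A ∩ A*` is the canonical masa and which is the limit of the algebras `A ∩ 𝔄ₙ`. -/
structure IsTAF (M : AFSystem 𝔄) (A : NonUnitalSubalgebra ℂ 𝔄) : Prop where
  isClosed : IsClosed (A : Set 𝔄)
  diagonal : ∀ a : 𝔄, (a ∈ A ∧ star a ∈ A) ↔ a ∈ M.masa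
  limit : (A : Set 𝔄) ⊆ closure (⋃ n, (A : Set 𝔄) ∩ M.level n)

/-- `A` is strongly maximal: it is triangular AF for some system for which every `A ∩ 𝔄ₙ` is
maximal triangular in `𝔄ₙ`, that is, the direct sum of the full upper triangular algebras. -/
def IsStronglyMaximalTAF (A : NonUnitalSubalgebra ℂ 𝔄) : Prop :=
  ∃ M : AFSystem 𝔄, IsTAF M A ∧ ∀ n, A.toSubmodule ⊓ M.level n = M.upper n

variable {A : NonUnitalSubalgebra ℂ 𝔄}

/-- A closed two-sided ideal `J` is meet irreducible if it is not the intersection of two closed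
two-sided ideals that both contain it properly. -/
def IsMeetIrreducible (J : TwoSidedIdeal A) : Prop :=
  IsClosed (J : Set A) ∧
    ∀ I₁ I₂ : TwoSidedIdeal A, IsClosed (I₁ : Set A) → IsClosed (I₂ : Set A) →
      J ≤ I₁ → J ≤ I₂ → I₁ ⊓ I₂ = J → I₁ = J ∨ I₂ = J

/-- A bounded nest representation: a bounded homomorphism into the bounded operators of a Hilbert
space whose closed invariant subspaces are totally ordered by inclusion. -/
structure IsBoundedNestRep {H : Type*} [NormedAddCommGroup H] [InnerProductSpace ℂ H]
    (π : A →ₙₐ[ℂ] (H →L[ℂ] H)) : Prop where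
  bounded : ∃ C : ℝ, ∀ a : A, ‖π a‖ ≤ C * ‖(a : 𝔄)‖
  nest : ∀ K L : Submodule ℂ H, IsClosed (K : Set H) → IsClosed (L : Set H) →
    (∀ a : A, ∀ h ∈ K, π a h ∈ K) → (∀ a : A, ∀ h ∈ L, π a h ∈ L) → K ≤ L ∨ L ≤ K

/-- An ideal is n-primitive if it is the kernel of a bounded nest representation on a Hilbert
space (in the universe `v`). -/
def IsNPrimitive.{v, u} {𝔄 : Type u} [NonUnitalCStarAlgebra 𝔄] {A : NonUnitalSubalgebra ℂ 𝔄}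
    (J : TwoSidedIdeal A) : Prop :=
  ∃ (H : Type v) (_ : NormedAddCommGroup H) (_ : InnerProductSpace ℂ H) (_ : CompleteSpace H)
    (π : A →ₙₐ[ℂ] (H →L[ℂ] H)), IsBoundedNestRep π ∧ TwoSidedIdeal.ker π = J

end TAF

universe u v

/-!
For the first part, let `I₁ ∩ I₂ = J = ker π`. The closed subspaces `[π(I₁)H]` and `[π(I₂)H]` are
invariant, hence comparable, say `[π(I₁)H] ≤ [π(I₂)H]`. Since the matrix units in an ideal fill
north-east corners, no row of `𝔄ₙ` meets both ideals outside `J`. The diagonal projection `pₙ` onto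
the rows in which `I₂` lies in `J` thus fixes `I₁ ∩ 𝔄ₙ` modulo `J`, while `π(pₙ)` tends strongly to
zero on `[π(I₂)H]`; hence `I₁ = J`.

For the converse, let `J` be meet-irreducible. Any two matrix units outside `J` dominate a common
one at arbitrarily high levels, so there is a refining sequence of cells (a matrix unit outside `J`
with a distinguished position between its row and its column) that is eventually dominated by every
matrix unit outside `J`. A state concentrated on the distinguished diagonal projections gives a
representation of `𝔄` with a unit vector `ξ` fixed by all of them. Its compression to the closed
span of the translates of `ξ` to the positions in the intervals of the cells is multiplicative
on `A`. A closed invariant subspace of the compression is determined by an initial set of positions,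
so these subspaces form a nest, and the kernel is `J` by the choice of the cells. The Hilbert space
is separable, hence can be replaced by one in any given universe.
-/

open Filter Topology

open scoped InnerProductSpace

section OrthogonalSums

variable {𝔄 ι : Type*} [NonUnitalCStarAlgebra 𝔄] {s : Finset ι}

theorem norm_sum_le_of_pairwise_orthogonal {a : ι → 𝔄} {C : ℝ} (hC : 0 ≤ C)
    (hl : (s : Set ι).Pairwise fun k l => star (a k) * a l = 0)
    (hr : (s : Set ι).Pairwise fun k l => a k * star (a l) = 0)
    (ha : ∀ k ∈ s, ‖a k‖ ≤ C) : ‖∑ k ∈ s, a k‖ ≤ C := by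
  classical
  let b : s → 𝔄 := fun k => star (a k) * a k
  lift C to NNReal using hC
  have hsum : star (∑ k ∈ s, a k) * ∑ k ∈ s, a k = ∑ k, b k := by
    rw [star_sum, Finset.sum_mul_sum]
    refine .trans (Finset.sum_congr rfl fun k hk => ?_)
      (Finset.sum_coe_sort s fun k => star (a k) * a k).symm
    exact Finset.sum_eq_single_of_mem k hk fun l h hlk => hl hk h hlk.symm
  have hb : ‖∑ k, b k‖₊ = Finset.univ.sup fun k => ‖b k‖₊ := by
    refine IsSelfAdjoint.nnnorm_sum_eq_sup _ (fun k _ => IsSelfAdjoint.star_mul_self _)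
      fun k l hkl => ?_
    change star (a k) * a k * (star (a l) * a l) = 0
    rw [mul_assoc, ← mul_assoc (a k), hr k.2 l.2 (Subtype.coe_ne_coe.2 hkl), zero_mul, mul_zero]
  have hle : ‖∑ k, b k‖₊ ≤ C * C := by
    rw [hb]
    refine Finset.sup_le fun k _ => ?_
    rw [CStarRing.nnnorm_star_mul_self]
    exact mul_le_mul' (ha k k.2) (ha k k.2)
  rw [← hsum, CStarRing.nnnorm_star_mul_self] at hle
  exact nonneg_le_nonneg_of_sq_le_sq C.2 (mod_cast hle)

end OrthogonalSums

namespace AFSystem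

section Units

variable {𝔄 : Type*} [NonUnitalCStarAlgebra 𝔄] (M : AFSystem 𝔄)

/-- The index set of the diagonal matrix units of `𝔄ₙ`. In the order of a disjoint sum, two indices
are comparable if and only if they belong to the same summand. -/
abbrev Idx (n : ℕ) := Σ r : Fin (M.blocks n), Fin (M.size n r)

/-- The matrix unit of `𝔄ₙ` in row `x` and column `y`; it is `0` when `x` and `y` belong to
different summands. -/
def unit (n : ℕ) (x y : M.Idx n) : 𝔄 :=
  if h : y.1 = x.1 then M.e n x.1 x.2 (h ▸ y.2) else 0

/-- The diagonal matrix units of `𝔄ₙ`. -/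
abbrev proj (n : ℕ) (x : M.Idx n) : 𝔄 := M.unit n x x

/-- The identity of `𝔄ₙ`. -/
def one (n : ℕ) : 𝔄 := ∑ x : M.Idx n, M.proj n x

variable {M} {n m : ℕ}

theorem unit_mk (r : Fin (M.blocks n)) (i j : Fin (M.size n r)) :
    M.unit n ⟨r, i⟩ ⟨r, j⟩ = M.e n r i j :=
  dif_pos rfl

theorem unit_of_fst_ne {x y : M.Idx n} (h : x.1 ≠ y.1) : M.unit n x y = 0 :=
  dif_neg fun h' => h h'.symm

theorem unit_ne_zero_iff {x y : M.Idx n} : M.unit n x y ≠ 0 ↔ x.1 = y.1 := by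
  refine ⟨fun h => by_contra fun h' => h (unit_of_fst_ne h'), ?_⟩
  obtain ⟨r, i⟩ := x
  obtain ⟨t, j⟩ := y
  rintro ⟨⟩
  rw [unit_mk]
  exact M.e_ne_zero n r i j

theorem proj_ne_zero (x : M.Idx n) : M.proj n x ≠ 0 := unit_ne_zero_iff.2 rfl

theorem star_unit (x y : M.Idx n) : star (M.unit n x y) = M.unit n y x := by
  by_cases h : x.1 = y.1
  · obtain ⟨r, i⟩ := x
    obtain ⟨t, j⟩ := y
    obtain rfl : r = t := h
    rw [unit_mk, unit_mk, M.star_e]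
  · rw [unit_of_fst_ne h, unit_of_fst_ne (Ne.symm h), star_zero]

theorem unit_mul_unit_of_ne (x : M.Idx n) {y z : M.Idx n} (w : M.Idx n) (h : y ≠ z) :
    M.unit n x y * M.unit n z w = 0 := by
  by_cases hxy : x.1 = y.1
  · by_cases hzw : z.1 = w.1
    · obtain ⟨r, i⟩ := x
      obtain ⟨r', j⟩ := y
      obtain ⟨t, k⟩ := z
      obtain ⟨t', l⟩ := w
      obtain rfl : r = r' := hxy
      obtain rfl : t = t' := hzw
      rw [unit_mk, unit_mk]
      by_cases hrt : r = t
      · subst hrt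
        rw [M.e_mul_e, if_neg fun hjk => h (by rw [hjk])]
      · exact M.e_mul_e_of_ne n r t i j k l hrt
    · rw [unit_of_fst_ne hzw, mul_zero]
  · rw [unit_of_fst_ne hxy, zero_mul]

theorem unit_mul_unit {x y w : M.Idx n} (h : x.1 = y.1 ∨ y.1 = w.1) :
    M.unit n x y * M.unit n y w = M.unit n x w := by
  by_cases hxy : x.1 = y.1
  · by_cases hyw : y.1 = w.1
    · obtain ⟨r, i⟩ := x
      obtain ⟨r', j⟩ := y
      obtain ⟨r'', k⟩ := w
      obtain rfl : r = r' := hxy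
      obtain rfl : r = r'' := hyw
      rw [unit_mk, unit_mk, unit_mk, M.e_mul_e, if_pos rfl]
    · rw [unit_of_fst_ne hyw, unit_of_fst_ne (hxy.trans_ne hyw), mul_zero]
  · rw [unit_of_fst_ne hxy,
      unit_of_fst_ne fun hxw => hxy (hxw.trans (h.resolve_left hxy).symm), zero_mul]

theorem proj_mul_unit (x y : M.Idx n) : M.proj n x * M.unit n x y = M.unit n x y :=
  unit_mul_unit (.inl rfl)

theorem unit_mul_proj (x y : M.Idx n) : M.unit n x y * M.proj n y = M.unit n x y :=
  unit_mul_unit (.inr rfl)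

theorem isStarProjection_proj (x : M.Idx n) : IsStarProjection (M.proj n x) :=
  ⟨proj_mul_unit x x, star_unit x x⟩

theorem norm_unit {x y : M.Idx n} (h : x.1 = y.1) : ‖M.unit n x y‖ = 1 := by
  have hproj : ‖M.proj n y‖ * ‖M.proj n y‖ = ‖M.proj n y‖ := by
    rw [← CStarRing.norm_star_mul_self, star_unit, proj_mul_unit]
  rw [mul_eq_left₀ (norm_ne_zero_iff.2 (proj_ne_zero y))] at hproj
  have hsq : ‖M.unit n x y‖ * ‖M.unit n x y‖ = 1 := by
    rw [← CStarRing.norm_star_mul_self, star_unit, unit_mul_unit (.inr h), hproj]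
  exact (mul_self_eq_one_iff.1 hsq).resolve_right fun h' => by linarith [norm_nonneg (M.unit n x y)]

theorem level_eq_span :
    M.level n = Submodule.span ℂ (Set.range fun x : M.Idx n × M.Idx n => M.unit n x.1 x.2) := by
  refine le_antisymm (Submodule.span_mono ?_) (Submodule.span_le.2 ?_)
  · rintro _ ⟨r, i, j, rfl⟩
    exact ⟨(⟨r, i⟩, ⟨r, j⟩), unit_mk r i j⟩
  · rintro _ ⟨⟨⟨r, i⟩, ⟨t, j⟩⟩, rfl⟩
    by_cases h : r = t
    · subst h
      exact Submodule.subset_span ⟨r, i, j, unit_mk r i j⟩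
    · simp [unit_of_fst_ne (x := (⟨r, i⟩ : M.Idx n)) (y := ⟨t, j⟩) h]

theorem upper_eq_span :
    M.upper n = Submodule.span ℂ {a | ∃ x y : M.Idx n, x ≤ y ∧ a = M.unit n x y} := by
  refine congrArg (Submodule.span ℂ) (Set.ext fun a => ⟨?_, ?_⟩)
  · rintro ⟨r, i, j, hij, rfl⟩
    exact ⟨⟨r, i⟩, ⟨r, j⟩, Sigma.mk_le_mk_iff.2 hij, (unit_mk r i j).symm⟩
  · rintro ⟨⟨r, i⟩, ⟨t, j⟩, hxy, rfl⟩
    obtain ⟨h, hij⟩ := Sigma.le_def.1 hxy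
    obtain rfl : r = t := h
    exact ⟨r, i, j, hij, unit_mk r i j⟩

theorem unit_mem_level (x y : M.Idx n) : M.unit n x y ∈ M.level n :=
  level_eq_span.ge (Submodule.subset_span ⟨(x, y), rfl⟩)

theorem unit_mem_upper {x y : M.Idx n} (h : x ≤ y) : M.unit n x y ∈ M.upper n :=
  upper_eq_span.ge (Submodule.subset_span ⟨x, y, h, rfl⟩)

theorem fst_eq_of_le {x y : M.Idx n} (h : x ≤ y) : x.1 = y.1 :=
  (Sigma.le_def.1 h).1

theorem le_total_of_fst_eq {x y : M.Idx n} (h : x.1 = y.1) : x ≤ y ∨ y ≤ x := by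
  obtain ⟨r, i⟩ := x
  obtain ⟨t, j⟩ := y
  obtain rfl : r = t := h
  exact (le_total i j).imp Sigma.mk_le_mk_iff.2 Sigma.mk_le_mk_iff.2

theorem star_mem_level {a : 𝔄} (ha : a ∈ M.level n) : star a ∈ M.level n := by
  rw [level_eq_span] at ha
  induction ha using Submodule.span_induction with
  | mem a h =>
    obtain ⟨⟨x, y⟩, rfl⟩ := h
    rw [star_unit]
    exact unit_mem_level y x
  | zero => simp only [star_zero, zero_mem]
  | add a b _ _ ha hb => rw [star_add]; exact add_mem ha hb
  | smul c a _ ha => rw [star_smul]; exact Submodule.smul_mem _ _ ha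

theorem one_mul_of_mem {a : 𝔄} (ha : a ∈ M.level n) : M.one n * a = a := by
  rw [level_eq_span] at ha
  induction ha using Submodule.span_induction with
  | mem a h =>
    obtain ⟨⟨x, y⟩, rfl⟩ := h
    rw [one, Finset.sum_mul, Finset.sum_eq_single x, proj_mul_unit]
    · exact fun z _ hz => unit_mul_unit_of_ne z y hz
    · exact fun h => absurd (Finset.mem_univ x) h
  | zero => exact mul_zero _
  | add a b _ _ ha hb => rw [mul_add, ha, hb]
  | smul c a _ ha => rw [mul_smul_comm, ha]

theorem star_one : star (M.one n) = M.one n := by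
  simp only [one, star_sum, star_unit]

theorem mul_one_of_mem {a : 𝔄} (ha : a ∈ M.level n) : a * M.one n = a := by
  rw [← star_star (a * _), star_mul, star_one, one_mul_of_mem (star_mem_level ha), star_star]

theorem eq_sum_corner {a : 𝔄} (ha : a ∈ M.level n) :
    a = ∑ x : M.Idx n × M.Idx n, M.proj n x.1 * a * M.proj n x.2 := by
  conv_lhs => rw [← mul_one_of_mem ha, ← one_mul_of_mem ha]
  simp only [one, Finset.sum_mul, Finset.mul_sum, Fintype.sum_prod_type_right]

/-- The scalars may be `ℕ`, which matters because refining a matrix unit produces coefficients in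
`ℕ`. -/
theorem exists_corner {R : Type*} [Semiring R] [Module R 𝔄] [IsScalarTower R 𝔄 𝔄]
    [SMulCommClass R 𝔄 𝔄] {a : 𝔄}
    (ha : a ∈ Submodule.span R (Set.range fun x : M.Idx n × M.Idx n => M.unit n x.1 x.2))
    (x y : M.Idx n) : ∃ c : R, M.proj n x * a * M.proj n y = c • M.unit n x y := by
  induction ha using Submodule.span_induction with
  | mem a h =>
    obtain ⟨⟨z, w⟩, rfl⟩ := h
    by_cases hz : x = z
    · by_cases hw : w = y
      · exact ⟨1, by rw [one_smul, hz, ← hw, proj_mul_unit, unit_mul_proj]⟩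
      · exact ⟨0, by rw [mul_assoc, unit_mul_unit_of_ne z y hw, mul_zero, zero_smul]⟩
    · exact ⟨0, by rw [unit_mul_unit_of_ne x w hz, zero_mul, zero_smul]⟩
  | zero => exact ⟨0, by rw [mul_zero, zero_mul, zero_smul]⟩
  | add a b _ _ ha hb =>
    obtain ⟨c, hc⟩ := ha
    obtain ⟨d, hd⟩ := hb
    exact ⟨c + d, by rw [mul_add, add_mul, hc, hd, add_smul]⟩
  | smul c a _ ha =>
    obtain ⟨d, hd⟩ := ha
    exact ⟨c * d, by rw [mul_smul_comm, smul_mul_assoc, hd, mul_smul]⟩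

theorem exists_corner_of_mem_level {a : 𝔄} (ha : a ∈ M.level n) (x y : M.Idx n) :
    ∃ c : ℂ, M.proj n x * a * M.proj n y = c • M.unit n x y :=
  exists_corner (level_eq_span.le ha) x y

theorem corner_eq_zero_of_not_le {a : 𝔄} (ha : a ∈ M.upper n) {x y : M.Idx n} (h : ¬x ≤ y) :
    M.proj n x * a * M.proj n y = 0 := by
  rw [upper_eq_span] at ha
  induction ha using Submodule.span_induction with
  | mem a ha =>
    obtain ⟨z, w, hzw, rfl⟩ := ha
    by_cases hz : x = z
    · rw [mul_assoc, unit_mul_unit_of_ne z y fun hw => h (by rwa [hz, ← hw]), mul_zero]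
    · rw [unit_mul_unit_of_ne x w hz, zero_mul]
  | zero => rw [mul_zero, zero_mul]
  | add a b _ _ ha hb => rw [mul_add, add_mul, ha, hb, add_zero]
  | smul c a _ ha => rw [mul_smul_comm, smul_mul_assoc, ha, smul_zero]

theorem le_of_unit_mem_upper {x y : M.Idx n} (hxy : x.1 = y.1) (h : M.unit n x y ∈ M.upper n) :
    x ≤ y := by
  by_contra hle
  have h0 := corner_eq_zero_of_not_le h hle
  rw [proj_mul_unit, unit_mul_proj] at h0
  exact unit_ne_zero_iff.2 hxy h0

theorem unit_mem_span_nat (hnm : n ≤ m) (x y : M.Idx n) : M.unit n x y ∈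
    Submodule.span ℕ (Set.range fun z : M.Idx m × M.Idx m => M.unit m z.1 z.2) := by
  induction m, hnm using Nat.le_induction with
  | base => exact Submodule.subset_span ⟨(x, y), rfl⟩
  | succ m _ ih =>
    refine Submodule.span_le.2 ?_ ih
    rintro _ ⟨⟨⟨r, i⟩, ⟨t, j⟩⟩, rfl⟩
    by_cases h : r = t
    · subst h
      obtain ⟨s, hs⟩ := M.refine_e m r i j
      simp only [unit_mk, hs]
      exact Submodule.sum_mem _ fun z _ =>
        Submodule.subset_span ⟨(⟨z.1, z.2.1⟩, ⟨z.1, z.2.2⟩), unit_mk _ _ _⟩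
    · simp [unit_of_fst_ne (x := (⟨r, i⟩ : M.Idx m)) (y := ⟨t, j⟩) h]

theorem level_mono : Monotone M.level := by
  intro n m hnm
  rw [level_eq_span]
  refine Submodule.span_le.2 ?_
  rintro _ ⟨⟨x, y⟩, rfl⟩
  rw [level_eq_span]
  exact Submodule.span_subset_span ℕ ℂ _ (unit_mem_span_nat hnm x y)

end Units

section Refinement

variable {𝔄 : Type*} [NonUnitalCStarAlgebra 𝔄] {M : AFSystem 𝔄} {n m : ℕ}

theorem sum_proj_mul_of_mem {a : 𝔄} (ha : a ∈ M.level n) : ∑ k : M.Idx n, M.proj n k * a = a := by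
  rw [← Finset.sum_mul]
  exact one_mul_of_mem ha

theorem mul_mem_level {a b : 𝔄} (ha : a ∈ M.level n) (hb : b ∈ M.level n) :
    a * b ∈ M.level n := by
  rw [eq_sum_corner ha, eq_sum_corner hb, Finset.sum_mul_sum]
  refine Submodule.sum_mem _ fun x _ => Submodule.sum_mem _ fun y _ => ?_
  obtain ⟨c, hc⟩ := exists_corner_of_mem_level ha x.1 x.2
  obtain ⟨d, hd⟩ := exists_corner_of_mem_level hb y.1 y.2
  rw [hc, hd, smul_mul_smul_comm]
  refine Submodule.smul_mem _ _ ?_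
  by_cases h : x.2 = y.1
  · by_cases h' : x.1.1 = x.2.1
    · rw [← h, unit_mul_unit (.inl h')]
      exact unit_mem_level _ _
    · rw [unit_of_fst_ne h', zero_mul]
      exact zero_mem _
  · rw [unit_mul_unit_of_ne _ _ h]
    exact zero_mem _

theorem unit_mem_level_of_le (hnm : n ≤ m) (x y : M.Idx n) : M.unit n x y ∈ M.level m :=
  level_mono hnm (unit_mem_level x y)

theorem exists_nat_column (hnm : n ≤ m) {s t : M.Idx n} (hst : s.1 = t.1) (y : M.Idx m) :
    ∃ c : M.Idx m → ℕ, (∀ k, M.proj m k * M.unit n s t * M.proj m y = c k • M.unit m k y) ∧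
      M.proj m y * M.proj n t * M.proj m y = (∑ k, c k ^ 2) • M.proj m y := by
  choose c₀ hc₀ using fun k => exists_corner (unit_mem_span_nat hnm s t) k y
  let c : M.Idx m → ℕ := fun k => if k.1 = y.1 then c₀ k else 0
  have hc : ∀ k, M.proj m k * M.unit n s t * M.proj m y = c k • M.unit m k y := fun k => by
    by_cases h : k.1 = y.1
    · rw [hc₀, show c k = c₀ k from if_pos h]
    · rw [hc₀, unit_of_fst_ne h, smul_zero, smul_zero]
  have hcol : M.unit n s t * M.proj m y = ∑ k, c k • M.unit m k y := by
    rw [← sum_proj_mul_of_mem (mul_mem_level (unit_mem_level_of_le hnm s t) (unit_mem_level y y))]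
    exact Finset.sum_congr rfl fun k _ => by rw [← mul_assoc, hc]
  refine ⟨c, hc, ?_⟩
  calc M.proj m y * M.proj n t * M.proj m y
      = star (M.unit n s t * M.proj m y) * (M.unit n s t * M.proj m y) := by
        have ht : M.proj n t = M.unit n t s * M.unit n s t := (unit_mul_unit (.inr hst)).symm
        rw [star_mul, star_unit, star_unit, ht]
        simp only [mul_assoc]
    _ = ∑ k, c k ^ 2 • (M.unit m y k * M.unit m k y) := by
        rw [hcol, star_sum, Finset.sum_mul_sum]
        refine Finset.sum_congr rfl fun k _ => ?_
        rw [Finset.sum_eq_single_of_mem k (Finset.mem_univ k), star_nsmul, star_unit,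
          smul_mul_smul_comm, ← sq]
        intro l _ hl
        rw [star_nsmul, star_unit, smul_mul_smul_comm, unit_mul_unit_of_ne _ _ hl.symm, smul_zero]
    _ = (∑ k, c k ^ 2) • M.proj m y := by
        rw [Finset.sum_smul]
        refine Finset.sum_congr rfl fun k _ => ?_
        by_cases h : k.1 = y.1
        · rw [unit_mul_unit (.inr h)]
        · simp [c, h]

/-- The coefficients `cₖ ∈ ℕ` of a column of a refined partial isometry satisfy `∑ cₖ² ≤ 1`. -/
theorem unit_mul_proj_eq (hnm : n ≤ m) {s t : M.Idx n} {z y : M.Idx m}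
    (h : M.proj m z * M.unit n s t * M.proj m y ≠ 0) :
    M.unit n s t * M.proj m y = M.unit m z y := by
  classical
  have hst : s.1 = t.1 := by
    refine unit_ne_zero_iff.1 fun h0 => h ?_
    rw [h0, mul_zero, zero_mul]
  obtain ⟨c, hc, hc2⟩ := exists_nat_column hnm hst y
  obtain ⟨d, hd, hd2⟩ := exists_nat_column hnm (rfl : t.1 = t.1) y
  have smul_inj : ∀ {i j : ℕ}, i • M.proj m y = j • M.proj m y → i = j := fun hij => by
    rw [← Nat.cast_smul_eq_nsmul ℂ, ← Nat.cast_smul_eq_nsmul ℂ] at hij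
    exact Nat.cast_injective (smul_left_injective ℂ (proj_ne_zero y) hij)
  have hdy : ∑ k, d k ^ 2 = d y := smul_inj (hd2.symm.trans (hd y))
  have hcd : ∑ k, c k ^ 2 = d y := smul_inj (hc2.symm.trans (hd y))
  have hd1 : d y ≤ 1 := by
    have : d y ^ 2 ≤ d y := (Finset.single_le_sum (f := fun k => d k ^ 2)
      (fun _ _ => Nat.zero_le _) (Finset.mem_univ y)).trans hdy.le
    nlinarith
  have hcz : c z ≠ 0 := fun h0 => h (by rw [hc, h0, zero_smul])
  have hsum : c z ^ 2 + ∑ k ∈ Finset.univ.erase z, c k ^ 2 ≤ 1 := by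
    rw [Finset.add_sum_erase _ (fun k => c k ^ 2) (Finset.mem_univ z), hcd]
    exact hd1
  have hz1 : c z = 1 := by nlinarith [Nat.pos_of_ne_zero hcz, Nat.le_of_add_right_le hsum]
  have hrest : ∀ k ≠ z, c k = 0 := fun k hk => by
    have h0 : ∑ k ∈ Finset.univ.erase z, c k ^ 2 = 0 := by rw [hz1] at hsum; omega
    exact pow_eq_zero_iff two_ne_zero |>.1
      (Finset.sum_eq_zero_iff.1 h0 k (Finset.mem_erase.2 ⟨hk, Finset.mem_univ k⟩))
  rw [← sum_proj_mul_of_mem (mul_mem_level (unit_mem_level_of_le hnm s t) (unit_mem_level y y)),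
    Finset.sum_eq_single_of_mem z (Finset.mem_univ z), ← mul_assoc, hc, hz1, one_smul]
  intro k _ hk
  rw [← mul_assoc, hc, hrest k hk, zero_smul]

theorem proj_mul_unit_eq (hnm : n ≤ m) {s t : M.Idx n} {z y : M.Idx m}
    (h : M.proj m z * M.unit n s t * M.proj m y ≠ 0) :
    M.proj m z * M.unit n s t = M.unit m z y := by
  have h' := unit_mul_proj_eq (s := t) (t := s) (z := y) (y := z) hnm fun h0 => h ?_
  · simpa only [star_mul, star_unit] using congrArg star h'
  · simpa only [star_mul, star_unit, mul_assoc, star_zero] using congrArg star h0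

theorem corner_eq_unit (hnm : n ≤ m) {s t : M.Idx n} {z y : M.Idx m}
    (h : M.proj m z * M.unit n s t * M.proj m y ≠ 0) :
    M.proj m z * M.unit n s t * M.proj m y = M.unit m z y := by
  rw [mul_assoc, unit_mul_proj_eq hnm h, proj_mul_unit]

theorem exists_unit_mul_proj_eq (hnm : n ≤ m) {s t : M.Idx n} {y : M.Idx m}
    (h : M.unit n s t * M.proj m y ≠ 0) :
    ∃ z, z.1 = y.1 ∧ M.unit n s t * M.proj m y = M.unit m z y := by
  obtain ⟨z, -, hz⟩ := Finset.exists_ne_zero_of_sum_ne_zero ((sum_proj_mul_of_mem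
    (mul_mem_level (unit_mem_level_of_le hnm s t) (unit_mem_level y y))).trans_ne h)
  rw [← mul_assoc] at hz
  have hzy := unit_mul_proj_eq hnm hz
  exact ⟨z, unit_ne_zero_iff.1 (hzy ▸ h), hzy⟩

end Refinement

section Corners

variable {𝔄 : Type*} [NonUnitalCStarAlgebra 𝔄] {M : AFSystem 𝔄} {n m : ℕ}

theorem norm_sum_corner_le {s : Finset (M.Idx n × M.Idx n)}
    (h₁ : Set.InjOn Prod.fst (s : Set (M.Idx n × M.Idx n)))
    (h₂ : Set.InjOn Prod.snd (s : Set (M.Idx n × M.Idx n)))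
    {a : M.Idx n × M.Idx n → 𝔄} {C : ℝ} (hC : 0 ≤ C) (ha : ∀ x ∈ s, ‖a x‖ ≤ C) :
    ‖∑ x ∈ s, M.proj n x.1 * a x * M.proj n x.2‖ ≤ C := by
  refine norm_sum_le_of_pairwise_orthogonal hC (fun x hx y hy hxy => ?_)
    (fun x hx y hy hxy => ?_) fun x hx => ?_
  · simp only [star_mul, star_unit, mul_assoc]
    rw [← mul_assoc (M.proj n x.1), unit_mul_unit_of_ne _ _ fun h => hxy (h₁ hx hy h), zero_mul,
      mul_zero, mul_zero]
  · simp only [star_mul, star_unit, mul_assoc]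
    rw [← mul_assoc (M.proj n x.2), unit_mul_unit_of_ne _ _ fun h => hxy (h₂ hx hy h), zero_mul,
      mul_zero, mul_zero]
  · calc ‖M.proj n x.1 * a x * M.proj n x.2‖
        ≤ ‖M.proj n x.1‖ * ‖a x‖ * ‖M.proj n x.2‖ := norm_mul₃_le
      _ = ‖a x‖ := by rw [norm_unit rfl, norm_unit rfl, one_mul, mul_one]
      _ ≤ C := ha x hx

theorem norm_corner_le (x y : M.Idx n) (a : 𝔄) : ‖M.proj n x * a * M.proj n y‖ ≤ ‖a‖ := by
  simpa using norm_sum_corner_le (s := {(x, y)}) (by simp) (by simp) (norm_nonneg a)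
    fun _ _ => le_rfl

theorem norm_sum_proj_le (s : Finset (M.Idx n)) : ‖∑ x ∈ s, M.proj n x‖ ≤ 1 := by
  refine norm_sum_le_of_pairwise_orthogonal zero_le_one (fun x _ y _ hxy => ?_)
    (fun x _ y _ hxy => ?_) fun x _ => (norm_unit rfl).le
  all_goals
    beta_reduce
    rw [star_unit, unit_mul_unit_of_ne x y hxy]

theorem norm_sum_corner_le_of_fiber {κ : Type*} [DecidableEq κ] (f : M.Idx n → κ)
    {a : M.Idx n × M.Idx n → 𝔄} {C : ℝ} (hC : 0 ≤ C)
    (h : ∀ c, ‖∑ x with f x.1 = c ∧ f x.2 = c, M.proj n x.1 * a x * M.proj n x.2‖ ≤ C) :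
    ‖∑ x with f x.1 = f x.2, M.proj n x.1 * a x * M.proj n x.2‖ ≤ C := by
  have hfiber : ∑ x with f x.1 = f x.2, M.proj n x.1 * a x * M.proj n x.2 =
      ∑ c ∈ Finset.univ.image f,
        ∑ x with f x.1 = c ∧ f x.2 = c, M.proj n x.1 * a x * M.proj n x.2 := by
    rw [← Finset.sum_fiberwise_of_maps_to
      fun x _ => Finset.mem_image_of_mem f (Finset.mem_univ x.1)]
    refine Finset.sum_congr rfl fun c _ => Finset.sum_congr ?_ fun _ _ => rfl
    ext x
    simp only [Finset.mem_filter, Finset.mem_univ, true_and]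
    constructor <;> rintro ⟨h, h'⟩ <;> simp [← h, h']
  rw [hfiber]
  refine norm_sum_le_of_pairwise_orthogonal hC (fun c _ d _ hcd => ?_) (fun c _ d _ hcd => ?_)
    fun c _ => h c
  all_goals
    beta_reduce
    rw [star_sum, Finset.sum_mul_sum]
    refine Finset.sum_eq_zero fun x hx => Finset.sum_eq_zero fun y hy => ?_
    simp only [Finset.mem_filter, Finset.mem_univ, true_and] at hx hy
    simp only [star_mul, star_unit, mul_assoc]
  · rw [← mul_assoc (M.proj n x.1), unit_mul_unit_of_ne _ _ fun hxy =>
      hcd (hx.1.symm.trans ((congrArg f hxy).trans hy.1)), zero_mul, mul_zero, mul_zero]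
  · rw [← mul_assoc (M.proj n x.2), unit_mul_unit_of_ne _ _ fun hxy =>
      hcd (hx.2.symm.trans ((congrArg f hxy).trans hy.2)), zero_mul, mul_zero, mul_zero]

theorem norm_sum_corner_le_norm {κ : Type*} [DecidableEq κ] (f : M.Idx n → κ)
    (a : 𝔄) : ‖∑ x : M.Idx n × M.Idx n with f x.1 = f x.2, M.proj n x.1 * a * M.proj n x.2‖ ≤
      ‖a‖ := by
  refine norm_sum_corner_le_of_fiber f (norm_nonneg a) fun c => ?_
  have hprod : ∑ x : M.Idx n × M.Idx n with f x.1 = c ∧ f x.2 = c,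
      M.proj n x.1 * a * M.proj n x.2 =
      (∑ x with f x = c, M.proj n x) * a * ∑ x with f x = c, M.proj n x := by
    rw [← Finset.univ_product_univ,
      Finset.filter_product (fun x => f x = c) fun x => f x = c, Finset.sum_product,
      Finset.sum_mul, Finset.sum_mul_sum]
  rw [hprod]
  calc _ ≤ _ := norm_mul₃_le
    _ ≤ 1 * ‖a‖ * 1 := by gcongr <;> exact norm_sum_proj_le _
    _ = ‖a‖ := by ring

theorem norm_sum_corner_le_of_card_fiber_le {κ : Type*} [DecidableEq κ]
    (f : M.Idx n → κ) {N : ℕ} (hN : ∀ c, Finset.card {x | f x = c} ≤ N)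
    {a : M.Idx n × M.Idx n → 𝔄} {C : ℝ} (hC : 0 ≤ C)
    (ha : ∀ x, ‖M.proj n x.1 * a x * M.proj n x.2‖ ≤ C) :
    ‖∑ x with f x.1 = f x.2, M.proj n x.1 * a x * M.proj n x.2‖ ≤ N ^ 2 * C := by
  refine norm_sum_corner_le_of_fiber f (by positivity) fun c => ?_
  have hcard : Finset.card {x : M.Idx n × M.Idx n | f x.1 = c ∧ f x.2 = c} ≤ N ^ 2 := by
    rw [← Finset.univ_product_univ,
      Finset.filter_product (fun x => f x = c) fun x => f x = c, Finset.card_product, sq]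
    exact Nat.mul_le_mul (hN c) (hN c)
  calc _ ≤ ∑ x : M.Idx n × M.Idx n with f x.1 = c ∧ f x.2 = c, C :=
        norm_sum_le_of_le _ fun x _ => ha x
    _ ≤ N ^ 2 * C := by
      rw [Finset.sum_const, nsmul_eq_mul]
      gcongr
      exact_mod_cast hcard

end Corners

section Linked

variable {𝔄 : Type*} [NonUnitalCStarAlgebra 𝔄] {M : AFSystem 𝔄} {n m : ℕ}

variable (M) in
/-- Two indices of `𝔄ₘ` are linked over `𝔄ₙ` if the corner of `𝔄ₙ` between the corresponding
diagonal matrix units of `𝔄ₘ` is nonzero (or if they are equal: the unit of `𝔄ₙ` may be smaller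
than that of `𝔄ₘ`). -/
def linked (hnm : n ≤ m) : Setoid (M.Idx m) where
  r y z := y = z ∨ ∃ s t, M.proj m y * M.unit n s t * M.proj m z ≠ 0
  iseqv := by
    refine ⟨fun y => .inl rfl, fun {y z} h => ?_, fun {y z w} h h' => ?_⟩
    · refine h.imp Eq.symm ?_
      rintro ⟨s, t, hst⟩
      refine ⟨t, s, fun h0 => hst ?_⟩
      simpa only [star_mul, star_unit, mul_assoc, star_zero] using congrArg star h0
    · obtain rfl | ⟨s, t, hst⟩ := h
      · exact h'
      obtain rfl | ⟨s', t', hst'⟩ := h'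
      · exact .inr ⟨s, t, hst⟩
      refine .inr ⟨s, t', fun h0 => ?_⟩
      have hyz : y.1 = z.1 := unit_ne_zero_iff.1 (corner_eq_unit hnm hst ▸ hst)
      have hzw : z.1 = w.1 := unit_ne_zero_iff.1 (corner_eq_unit hnm hst' ▸ hst')
      have hprod : M.proj m y * (M.unit n s t * M.unit n s' t') * M.proj m w = M.unit m y w := by
        rw [← mul_assoc, mul_assoc, proj_mul_unit_eq hnm hst, unit_mul_proj_eq hnm hst',
          unit_mul_unit (.inl hyz)]
      have hts : t = s' := by
        by_contra hne
        rw [unit_mul_unit_of_ne s t' hne, mul_zero, zero_mul] at hprod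
        exact unit_ne_zero_iff.2 (hyz.trans hzw) hprod.symm
      have hst0 : s.1 = t.1 := unit_ne_zero_iff.1 fun h => hst (by rw [h, mul_zero, zero_mul])
      rw [← hts, unit_mul_unit (.inl hst0), h0] at hprod
      exact unit_ne_zero_iff.2 (hyz.trans hzw) hprod.symm

theorem corner_eq_zero_of_not_linked (hnm : n ≤ m) {y z : M.Idx m}
    (h : ¬M.linked hnm y z) {a : 𝔄} (ha : a ∈ M.level n) :
    M.proj m y * a * M.proj m z = 0 := by
  rw [level_eq_span] at ha
  induction ha using Submodule.span_induction with
  | mem a ha =>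
    obtain ⟨⟨s, t⟩, rfl⟩ := ha
    by_contra hne
    exact h (.inr ⟨s, t, hne⟩)
  | zero => rw [mul_zero, zero_mul]
  | add a b _ _ ha hb => rw [mul_add, add_mul, ha, hb, add_zero]
  | smul c a _ ha => rw [mul_smul_comm, smul_mul_assoc, ha, smul_zero]

theorem card_linked_le (hnm : n ≤ m) (y : M.Idx m) [DecidableRel (M.linked hnm)] :
    Finset.card {z | M.linked hnm z y} ≤ Fintype.card (M.Idx n × M.Idx n) + 1 := by
  classical
  have : Nonempty (M.Idx m) := ⟨y⟩
  choose! g hg using fun (x : M.Idx n × M.Idx n)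
    (h : ∃ z, M.proj m z * M.unit n x.1 x.2 * M.proj m y ≠ 0) => h
  have hsub : ({z | M.linked hnm z y} : Finset (M.Idx m)) ⊆ insert y (Finset.univ.image g) := by
    intro z hz
    obtain rfl | ⟨s, t, hst⟩ := (Finset.mem_filter.1 hz).2
    · exact Finset.mem_insert_self _ _
    · refine Finset.mem_insert_of_mem (Finset.mem_image.2 ⟨(s, t), Finset.mem_univ _, ?_⟩)
      by_contra hne
      have hgz := unit_mul_proj_eq hnm (hg (s, t) ⟨z, hst⟩)
      refine hst ?_
      rw [mul_assoc, hgz, unit_mul_unit_of_ne z y (Ne.symm hne)]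
  calc _ ≤ _ := Finset.card_le_card hsub
    _ ≤ _ := Finset.card_insert_le _ _
    _ ≤ _ := by gcongr; exact Finset.card_image_le

end Linked

end AFSystem

section ClosedIdeals

variable {𝔄 : Type*} [NonUnitalCStarAlgebra 𝔄]

/-- The closed two-sided ideals of a subalgebra `A` of `𝔄`, as subspaces of `𝔄`. -/
structure IsClosedIdeal (A : NonUnitalSubalgebra ℂ 𝔄) (I : Submodule ℂ 𝔄) : Prop where
  le : I ≤ A.toSubmodule
  isClosed : IsClosed (I : Set 𝔄)
  mul_mem_left : ∀ a ∈ A, ∀ b ∈ I, a * b ∈ I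
  mul_mem_right : ∀ a ∈ A, ∀ b ∈ I, b * a ∈ I

end ClosedIdeals

namespace AFSystem

section StronglyMaximal

variable {𝔄 : Type*} [NonUnitalCStarAlgebra 𝔄] {M : AFSystem 𝔄} {A : NonUnitalSubalgebra ℂ 𝔄}
  {n m : ℕ}

theorem mem_upper_iff (hU : ∀ n, A.toSubmodule ⊓ M.level n = M.upper n) {a : 𝔄} :
    a ∈ M.upper n ↔ a ∈ A ∧ a ∈ M.level n := by
  rw [← hU]
  exact Submodule.mem_inf

theorem upper_mono (hU : ∀ n, A.toSubmodule ⊓ M.level n = M.upper n) : Monotone M.upper := by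
  intro n m hnm
  rw [← hU, ← hU]
  exact inf_le_inf_left _ (level_mono hnm)

theorem exists_mem_upper_norm_sub_lt (hA : IsTAF M A)
    (hU : ∀ n, A.toSubmodule ⊓ M.level n = M.upper n) {a : 𝔄} (ha : a ∈ A) (n : ℕ) {ε : ℝ}
    (hε : 0 < ε) : ∃ m, n ≤ m ∧ ∃ b ∈ M.upper m, ‖a - b‖ < ε := by
  obtain ⟨b, hb, hab⟩ := Metric.mem_closure_iff.1 (hA.limit ha) ε hε
  obtain ⟨k, hbA, hbk⟩ := Set.mem_iUnion.1 hb
  refine ⟨max n k, le_max_left n k, b, (mem_upper_iff hU).2 ⟨hbA, ?_⟩, dist_eq_norm a b ▸ hab⟩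
  exact level_mono (le_max_right n k) hbk

theorem subset_closure_iUnion_upper (hA : IsTAF M A)
    (hU : ∀ n, A.toSubmodule ⊓ M.level n = M.upper n) :
    (A : Set 𝔄) ⊆ closure (⋃ n, (M.upper n : Set 𝔄)) := fun a ha => by
  refine Metric.mem_closure_iff.2 fun ε hε => ?_
  obtain ⟨n, -, b, hb, hab⟩ := exists_mem_upper_norm_sub_lt hA hU ha 0 hε
  exact ⟨b, Set.mem_iUnion.2 ⟨n, hb⟩, dist_eq_norm a b ▸ hab⟩

theorem proj_mem (hU : ∀ n, A.toSubmodule ⊓ M.level n = M.upper n) (x : M.Idx n) :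
    M.proj n x ∈ A :=
  ((mem_upper_iff hU).1 (unit_mem_upper le_rfl)).1

theorem corner_mem (hU : ∀ n, A.toSubmodule ⊓ M.level n = M.upper n) {I : Submodule ℂ 𝔄}
    (hI : IsClosedIdeal A I) {a : 𝔄} (ha : a ∈ I) (x y : M.Idx n) :
    M.proj n x * a * M.proj n y ∈ I :=
  hI.mul_mem_right _ (proj_mem hU y) _ (hI.mul_mem_left _ (proj_mem hU x) _ ha)

end StronglyMaximal

section Synthesis

variable {𝔄 : Type*} [NonUnitalCStarAlgebra 𝔄] {M : AFSystem 𝔄} {A : NonUnitalSubalgebra ℂ 𝔄}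
  {n m : ℕ}

theorem corner_right_unique (hnm : n ≤ m) {s t : M.Idx n} {x y y' : M.Idx m}
    (h : M.proj m x * M.unit n s t * M.proj m y ≠ 0)
    (h' : M.proj m x * M.unit n s t * M.proj m y' ≠ 0) : y = y' := by
  have hrow : M.unit m x y = M.unit m x y' :=
    (proj_mul_unit_eq hnm h).symm.trans (proj_mul_unit_eq hnm h')
  by_contra hy
  refine h ?_
  rw [corner_eq_unit hnm h, ← unit_mul_proj, hrow, unit_mul_unit_of_ne x y (Ne.symm hy)]

theorem corner_left_unique (hnm : n ≤ m) {s t : M.Idx n} {x x' y : M.Idx m}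
    (h : M.proj m x * M.unit n s t * M.proj m y ≠ 0)
    (h' : M.proj m x' * M.unit n s t * M.proj m y ≠ 0) : x = x' := by
  have hcol : M.unit m x y = M.unit m x' y :=
    (unit_mul_proj_eq hnm h).symm.trans (unit_mul_proj_eq hnm h')
  by_contra hx
  refine h ?_
  rw [corner_eq_unit hnm h, ← proj_mul_unit, hcol, unit_mul_unit_of_ne x y hx]

theorem exists_norm_unit_sub_sum_corner_le (hnm : n ≤ m) (s t : M.Idx n) {z w : 𝔄} {δ : ℝ}
    (hw : w ∈ M.level m) (hzw : ‖w - z‖ ≤ δ) (h : ‖w - M.unit n s t‖ ≤ 1 / 2) :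
    ∃ (S : Finset (M.Idx m × M.Idx m)) (c : M.Idx m × M.Idx m → ℂ),
      ‖M.unit n s t - ∑ p ∈ S, c p • (M.proj m p.1 * z * M.proj m p.2)‖ ≤ 2 * δ := by
  classical
  let S : Finset (M.Idx m × M.Idx m) := {p | M.proj m p.1 * M.unit n s t * M.proj m p.2 ≠ 0}
  have hS : ∀ p ∈ S, M.proj m p.1 * M.unit n s t * M.proj m p.2 ≠ 0 := fun p hp => by
    simpa [S] using hp
  choose c hc using fun p : M.Idx m × M.Idx m => exists_corner_of_mem_level hw p.1 p.2
  have hne : ∀ p ∈ S, M.unit m p.1 p.2 ≠ 0 := fun p hp => corner_eq_unit hnm (hS p hp) ▸ hS p hp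
  have hc_sub : ∀ p ∈ S, ‖1 - c p‖ ≤ 1 / 2 := fun p hp => by
    have hnorm := (norm_corner_le p.1 p.2 (w - M.unit n s t)).trans h
    have hid : M.proj m p.1 * (w - M.unit n s t) * M.proj m p.2 = (c p - 1) • M.unit m p.1 p.2 := by
      rw [mul_sub, sub_mul, hc, corner_eq_unit hnm (hS p hp), sub_smul, one_smul]
    rwa [hid, norm_smul, norm_unit (unit_ne_zero_iff.1 (hne p hp)), mul_one, norm_sub_rev] at hnorm
  have hc_le : ∀ p ∈ S, 1 / 2 ≤ ‖c p‖ := fun p hp => by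
    have := norm_sub_norm_le (1 : ℂ) (c p)
    rw [norm_one] at this
    linarith [hc_sub p hp]
  refine ⟨S, fun p => (c p)⁻¹, ?_⟩
  have hsum : M.unit n s t - ∑ p ∈ S, (c p)⁻¹ • (M.proj m p.1 * z * M.proj m p.2) =
      ∑ p ∈ S, M.proj m p.1 * ((c p)⁻¹ • (w - z)) * M.proj m p.2 := by
    conv_lhs => rw [eq_sum_corner (unit_mem_level_of_le hnm s t), ← Finset.sum_filter_ne_zero,
      ← Finset.sum_sub_distrib]
    refine Finset.sum_congr rfl fun p hp => ?_
    have hcp : c p ≠ 0 := norm_pos_iff.1 (by linarith [hc_le p hp])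
    rw [mul_smul_comm, smul_mul_assoc, mul_sub, sub_mul, smul_sub, hc, smul_smul,
      inv_mul_cancel₀ hcp, one_smul, corner_eq_unit hnm (hS p hp)]
  rw [hsum]
  have hδ : 0 ≤ δ := (norm_nonneg _).trans hzw
  refine norm_sum_corner_le ?_ ?_ (by positivity) fun p hp => ?_
  · rintro ⟨x, y⟩ hp ⟨x', y'⟩ hq (rfl : x = x')
    exact Prod.ext rfl (corner_right_unique hnm (hS (x, y) hp) (hS (x, y') hq))
  · rintro ⟨x, y⟩ hp ⟨x', y'⟩ hq (rfl : y = y')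
    exact Prod.ext (corner_left_unique hnm (hS (x, y) hp) (hS (x', y) hq)) rfl
  · rw [norm_smul, norm_inv]
    gcongr
    exact inv_le_of_inv_le₀ (by norm_num) (by linarith [hc_le p hp])

theorem unit_mem_of_norm_sub_le (hA : IsTAF M A)
    (hU : ∀ n, A.toSubmodule ⊓ M.level n = M.upper n) {I : Submodule ℂ 𝔄} (hI : IsClosedIdeal A I)
    {s t : M.Idx n} {z : 𝔄} (hz : z ∈ I) (h : ‖z - M.unit n s t‖ ≤ 1 / 4) : M.unit n s t ∈ I := by
  rw [← SetLike.mem_coe, ← hI.isClosed.closure_eq, Metric.mem_closure_iff]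
  intro ε hε
  obtain ⟨m, hnm, w, hw, hzw⟩ := exists_mem_upper_norm_sub_lt hA hU (hI.le hz) n
    (lt_min (by norm_num : (0 : ℝ) < 1 / 4) (by positivity : (0 : ℝ) < ε / 3))
  rw [norm_sub_rev] at hzw
  have hwu : ‖w - M.unit n s t‖ ≤ 1 / 2 := by
    linarith [norm_sub_le_norm_sub_add_norm_sub w z (M.unit n s t), hzw.trans_le (min_le_left _ _)]
  obtain ⟨S, c, hb⟩ := exists_norm_unit_sub_sum_corner_le hnm s t
    ((mem_upper_iff hU).1 hw).2 (hzw.le.trans (min_le_right _ _)) hwu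
  refine ⟨_, Submodule.sum_mem I fun p (_ : p ∈ S) =>
    I.smul_mem (c p) (corner_mem hU hI hz p.1 p.2), ?_⟩
  rw [dist_eq_norm]
  linarith

theorem unit_mem_of_lt_norm_corner (hA : IsTAF M A)
    (hU : ∀ n, A.toSubmodule ⊓ M.level n = M.upper n) {I : Submodule ℂ 𝔄} (hI : IsClosedIdeal A I)
    {a w : 𝔄} (ha : a ∈ I) (hw : w ∈ M.level n) {δ : ℝ} (haw : ‖a - w‖ ≤ δ) {x y : M.Idx n}
    (h : 4 * δ < ‖M.proj n x * w * M.proj n y‖) : M.unit n x y ∈ I := by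
  obtain ⟨c, hc⟩ := exists_corner_of_mem_level hw x y
  have hδ : 0 ≤ δ := (norm_nonneg _).trans haw
  have hne : c • M.unit n x y ≠ 0 := hc ▸ norm_pos_iff.1 (by linarith)
  obtain ⟨hc0, hxy⟩ := smul_ne_zero_iff.1 hne
  rw [hc, norm_smul, norm_unit (unit_ne_zero_iff.1 hxy), mul_one] at h
  refine unit_mem_of_norm_sub_le hA hU hI
    (I.smul_mem c⁻¹ (corner_mem hU hI ha x y)) ?_
  have hid : c⁻¹ • (M.proj n x * a * M.proj n y) - M.unit n x y =
      c⁻¹ • (M.proj n x * (a - w) * M.proj n y) := by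
    rw [mul_sub, sub_mul, hc, smul_sub, inv_smul_smul₀ hc0]
  rw [hid, norm_smul, norm_inv, inv_mul_le_iff₀ (by linarith)]
  linarith [(norm_corner_le x y (a - w)).trans haw]

theorem norm_sub_sum_linked_le (hnm : n ≤ m) {κ : Type*} [DecidableEq κ]
    {f : M.Idx m → κ} (hf : ∀ {y z}, M.linked hnm y z → f y = f z) {a : 𝔄} (ha : a ∈ M.level n)
    (w : 𝔄) : ‖a - ∑ p : M.Idx m × M.Idx m with f p.1 = f p.2,
      M.proj m p.1 * w * M.proj m p.2‖ ≤ ‖a - w‖ := by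
  have hpinch : a = ∑ p : M.Idx m × M.Idx m with f p.1 = f p.2,
      M.proj m p.1 * a * M.proj m p.2 := by
    conv_lhs => rw [eq_sum_corner (level_mono hnm ha)]
    refine (Finset.sum_filter_of_ne fun p _ hp => hf ?_).symm
    exact by_contra fun h => hp (corner_eq_zero_of_not_linked hnm h ha)
  conv_lhs => rw [hpinch, ← Finset.sum_sub_distrib]
  simp only [← sub_mul, ← mul_sub]
  exact norm_sum_corner_le_norm f (a - w)

theorem norm_sum_corner_sub_sum_large_le {κ : Type*} [DecidableEq κ]
    {f : M.Idx n → κ} {N : ℕ} (hN : ∀ c, Finset.card {x | f x = c} ≤ N) (w : 𝔄) {τ : ℝ}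
    (hτ : 0 ≤ τ) :
    ‖∑ p : M.Idx n × M.Idx n with f p.1 = f p.2, M.proj n p.1 * w * M.proj n p.2 -
      ∑ p : M.Idx n × M.Idx n with f p.1 = f p.2 ∧ τ < ‖M.proj n p.1 * w * M.proj n p.2‖,
        M.proj n p.1 * w * M.proj n p.2‖ ≤ N ^ 2 * τ := by
  let small (p : M.Idx n × M.Idx n) : 𝔄 := if τ < ‖M.proj n p.1 * w * M.proj n p.2‖ then 0 else w
  have hsmall : ∀ p, ‖M.proj n p.1 * small p * M.proj n p.2‖ ≤ τ := fun p => by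
    by_cases h : τ < ‖M.proj n p.1 * w * M.proj n p.2‖
    · simpa [small, h] using hτ
    · simpa [small, h] using not_lt.1 h
  refine le_of_eq_of_le (congrArg norm ?_) (norm_sum_corner_le_of_card_fiber_le f hN hτ hsmall)
  rw [← Finset.filter_filter, Finset.sum_filter (fun p => τ < _), ← Finset.sum_sub_distrib]
  refine Finset.sum_congr rfl fun p _ => ?_
  by_cases h : τ < ‖M.proj n p.1 * w * M.proj n p.2‖ <;> simp [small, h]

/-- Pinch an approximant `w ∈ 𝔄ₘ` of `a` to the corners linked over a fixed `𝔄ₙ`. The large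
corners have their matrix units in `I`; since the number of indices linked to a given one is
bounded independently of `m`, the small ones are negligible. -/
theorem le_of_unit_mem (hA : IsTAF M A) (hU : ∀ n, A.toSubmodule ⊓ M.level n = M.upper n)
    {I J : Submodule ℂ 𝔄} (hI : IsClosedIdeal A I) (hJ : IsClosed (J : Set 𝔄))
    (h : ∀ (n : ℕ) (x y : M.Idx n), M.unit n x y ∈ I → M.unit n x y ∈ J) : I ≤ J := by
  classical
  intro a ha
  rw [← SetLike.mem_coe, ← hJ.closure_eq, Metric.mem_closure_iff]
  intro ε hε
  obtain ⟨n, -, b, hb, hab⟩ :=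
    exists_mem_upper_norm_sub_lt hA hU (hI.le ha) 0 (by positivity : 0 < ε / 8)
  let N : ℕ := Fintype.card (M.Idx n × M.Idx n) + 1
  obtain ⟨δ, hδ, hδε, hNδ⟩ : ∃ δ : ℝ, 0 < δ ∧ δ ≤ ε / 8 ∧ N ^ 2 * (4 * δ) ≤ ε / 4 := by
    have hN0 : (N : ℝ) ≠ 0 := Nat.cast_ne_zero.2 (Nat.succ_ne_zero _)
    have hN : (1 : ℝ) ≤ (N : ℝ) ^ 2 := one_le_pow₀ (by exact_mod_cast Nat.le_add_left 1 _)
    refine ⟨ε / (16 * N ^ 2), by positivity, ?_, ?_⟩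
    · gcongr
      linarith
    · field_simp
      norm_num
  obtain ⟨m, hnm, w, hw, haw⟩ := exists_mem_upper_norm_sub_lt hA hU (hI.le ha) n hδ
  have hwm := ((mem_upper_iff hU).1 hw).2
  let f : M.Idx m → Quotient (M.linked hnm) := Quotient.mk _
  have hcard : ∀ c, Finset.card {x | f x = c} ≤ N := fun c => by
    obtain ⟨y, rfl⟩ := Quotient.exists_rep c
    simpa only [f, Quotient.eq] using card_linked_le hnm y
  have hpinch := norm_sub_sum_linked_le hnm (f := f) Quotient.sound ((mem_upper_iff hU).1 hb).2 w
  have hlarge := norm_sum_corner_sub_sum_large_le hcard w (by positivity : 0 ≤ 4 * δ)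
  refine ⟨∑ p : M.Idx m × M.Idx m with f p.1 = f p.2 ∧ 4 * δ < ‖M.proj m p.1 * w * M.proj m p.2‖,
    M.proj m p.1 * w * M.proj m p.2, Submodule.sum_mem _ fun p hp => ?_, ?_⟩
  · obtain ⟨c, hc⟩ := exists_corner_of_mem_level hwm p.1 p.2
    rw [hc]
    exact J.smul_mem c (h m _ _ (unit_mem_of_lt_norm_corner hA hU hI ha hwm haw.le
      (Finset.mem_filter.1 hp).2.2))
  · rw [dist_eq_norm]
    have hbw := norm_sub_le_norm_sub_add_norm_sub b a w
    rw [norm_sub_rev b a] at hbw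
    set Φ := ∑ p : M.Idx m × M.Idx m with f p.1 = f p.2, M.proj m p.1 * w * M.proj m p.2
    have haΦ := norm_sub_le_norm_sub_add_norm_sub a b Φ
    refine (norm_sub_le_norm_sub_add_norm_sub a Φ _).trans_lt ?_
    linarith

end Synthesis

section ApproximateIdentity

variable {𝔄 : Type*} [NonUnitalCStarAlgebra 𝔄] {M : AFSystem 𝔄} {A : NonUnitalSubalgebra ℂ 𝔄}

theorem tendsto_one_mul (hA : IsTAF M A) (hU : ∀ n, A.toSubmodule ⊓ M.level n = M.upper n)
    {a : 𝔄} (ha : a ∈ A) : Tendsto (fun n => M.one n * a) atTop (𝓝 a) := by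
  rw [Metric.tendsto_atTop]
  intro ε hε
  obtain ⟨n, -, b, hb, hab⟩ := exists_mem_upper_norm_sub_lt hA hU ha 0 (half_pos hε)
  refine ⟨n, fun m hnm => ?_⟩
  have hbm : M.one m * b = b := one_mul_of_mem (level_mono hnm ((mem_upper_iff hU).1 hb).2)
  have hsub : M.one m * a - a = M.one m * (a - b) - (a - b) := by
    rw [mul_sub, hbm]
    abel
  have hcontr : ‖M.one m * (a - b)‖ ≤ ‖a - b‖ :=
    (norm_mul_le _ _).trans (mul_le_of_le_one_left (norm_nonneg _) (norm_sum_proj_le _))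
  rw [dist_eq_norm, hsub]
  linarith [norm_sub_le (M.one m * (a - b)) (a - b)]

end ApproximateIdentity

end AFSystem

namespace IsClosedIdeal

variable {𝔄 : Type*} [NonUnitalCStarAlgebra 𝔄] {M : AFSystem 𝔄} {A : NonUnitalSubalgebra ℂ 𝔄}
  {I I₁ I₂ : Submodule ℂ 𝔄}

theorem inf (h₁ : IsClosedIdeal A I₁) (h₂ : IsClosedIdeal A I₂) : IsClosedIdeal A (I₁ ⊓ I₂) where
  le := inf_le_left.trans h₁.le
  isClosed := h₁.isClosed.inter h₂.isClosed
  mul_mem_left a ha b hb := ⟨h₁.mul_mem_left a ha b hb.1, h₂.mul_mem_left a ha b hb.2⟩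
  mul_mem_right a ha b hb := ⟨h₁.mul_mem_right a ha b hb.1, h₂.mul_mem_right a ha b hb.2⟩

/-- A closed ideal of `A`, given as a subspace of `𝔄`, as a two-sided ideal of the ring `A`. -/
def toTwoSidedIdeal (hI : IsClosedIdeal A I) : TwoSidedIdeal A :=
  TwoSidedIdeal.mk' {a : A | (a : 𝔄) ∈ I} I.zero_mem (fun ha hb => I.add_mem ha hb)
    (fun ha => I.neg_mem ha) (fun {a _} hb => hI.mul_mem_left a a.2 _ hb)
    (fun {_ a} hb => hI.mul_mem_right a a.2 _ hb)

theorem mem_toTwoSidedIdeal (hI : IsClosedIdeal A I) {a : A} :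
    a ∈ hI.toTwoSidedIdeal ↔ (a : 𝔄) ∈ I := by
  simp [toTwoSidedIdeal]

theorem isClosed_toTwoSidedIdeal (hI : IsClosedIdeal A I) :
    IsClosed (hI.toTwoSidedIdeal : Set A) := by
  have hpre : (hI.toTwoSidedIdeal : Set A) = Subtype.val ⁻¹' (I : Set 𝔄) :=
    Set.ext fun _ => hI.mem_toTwoSidedIdeal
  rw [hpre]
  exact hI.isClosed.preimage continuous_subtype_val

theorem toTwoSidedIdeal_inj (h₁ : IsClosedIdeal A I₁) (h₂ : IsClosedIdeal A I₂) :
    h₁.toTwoSidedIdeal = h₂.toTwoSidedIdeal ↔ I₁ = I₂ := by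
  refine ⟨fun h => ?_, by rintro rfl; rfl⟩
  have hmem : ∀ a : A, (a : 𝔄) ∈ I₁ ↔ (a : 𝔄) ∈ I₂ := fun a => by
    rw [← h₁.mem_toTwoSidedIdeal, h, h₂.mem_toTwoSidedIdeal]
  exact le_antisymm (fun a ha => (hmem ⟨a, h₁.le ha⟩).1 ha) fun a ha => (hmem ⟨a, h₂.le ha⟩).2 ha

theorem toTwoSidedIdeal_inf (h₁ : IsClosedIdeal A I₁) (h₂ : IsClosedIdeal A I₂) :
    h₁.toTwoSidedIdeal ⊓ h₂.toTwoSidedIdeal = (h₁.inf h₂).toTwoSidedIdeal := by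
  ext a
  rw [TwoSidedIdeal.mem_inf, mem_toTwoSidedIdeal, mem_toTwoSidedIdeal, mem_toTwoSidedIdeal]
  rfl

/-- A two-sided ideal of a nonunital ring need not be closed under scalars; a closed one is,
because `c • a = lim (c • 1ₙ) * a`. -/
theorem exists_toTwoSidedIdeal_eq (hA : IsTAF M A)
    (hU : ∀ n, A.toSubmodule ⊓ M.level n = M.upper n) {J : TwoSidedIdeal A}
    (hJ : IsClosed (J : Set A)) :
    ∃ (I : Submodule ℂ 𝔄) (hI : IsClosedIdeal A I), hI.toTwoSidedIdeal = J := by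
  let S : Set 𝔄 := Subtype.val '' (J : Set A)
  have hS : IsClosed S := hA.isClosed.isClosedEmbedding_subtypeVal.isClosedMap _ hJ
  let I : Submodule ℂ 𝔄 :=
    { carrier := S
      zero_mem' := ⟨0, J.zero_mem, rfl⟩
      add_mem' := by
        rintro _ _ ⟨a, ha, rfl⟩ ⟨b, hb, rfl⟩
        exact ⟨a + b, J.add_mem ha hb, rfl⟩
      smul_mem' := by
        rintro c _ ⟨a, ha, rfl⟩
        refine hS.mem_of_tendsto ((AFSystem.tendsto_one_mul hA hU a.2).const_smul c)
          (Eventually.of_forall fun n => ?_)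
        have hone : M.one n ∈ A := A.toSubmodule.sum_mem fun x _ => AFSystem.proj_mem hU x
        exact ⟨c • ⟨M.one n, hone⟩ * a, J.mul_mem_left _ _ ha, smul_mul_assoc c (M.one n) (a : 𝔄)⟩ }
  have hI : IsClosedIdeal A I :=
    { le := by
        rintro _ ⟨a, -, rfl⟩
        exact a.2
      isClosed := hS
      mul_mem_left := by
        rintro b hb _ ⟨a, ha, rfl⟩
        exact ⟨⟨b, hb⟩ * a, J.mul_mem_left _ _ ha, rfl⟩
      mul_mem_right := by
        rintro b hb _ ⟨a, ha, rfl⟩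
        exact ⟨a * ⟨b, hb⟩, J.mul_mem_right _ _ ha, rfl⟩ }
  refine ⟨I, hI, TwoSidedIdeal.ext fun a => hI.mem_toTwoSidedIdeal.trans ?_⟩
  exact Subtype.val_injective.mem_set_image

theorem isMeetIrreducible_toTwoSidedIdeal_iff (hA : IsTAF M A)
    (hU : ∀ n, A.toSubmodule ⊓ M.level n = M.upper n) (hI : IsClosedIdeal A I) :
    IsMeetIrreducible hI.toTwoSidedIdeal ↔
      ∀ I₁ I₂, IsClosedIdeal A I₁ → IsClosedIdeal A I₂ → I₁ ⊓ I₂ = I → I₁ = I ∨ I₂ = I := by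
  refine ⟨fun h I₁ I₂ h₁ h₂ hinf => ?_, fun h => ⟨hI.isClosed_toTwoSidedIdeal, ?_⟩⟩
  · have hinf' : h₁.toTwoSidedIdeal ⊓ h₂.toTwoSidedIdeal = hI.toTwoSidedIdeal :=
      (toTwoSidedIdeal_inf h₁ h₂).trans ((toTwoSidedIdeal_inj _ hI).2 hinf)
    rw [← toTwoSidedIdeal_inj h₁ hI, ← toTwoSidedIdeal_inj h₂ hI]
    exact h.2 _ _ h₁.isClosed_toTwoSidedIdeal h₂.isClosed_toTwoSidedIdeal
      (hinf'.ge.trans inf_le_left) (hinf'.ge.trans inf_le_right) hinf'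
  · intro J₁ J₂ hJ₁ hJ₂ _ _ hinf
    obtain ⟨I₁, h₁, rfl⟩ := exists_toTwoSidedIdeal_eq hA hU hJ₁
    obtain ⟨I₂, h₂, rfl⟩ := exists_toTwoSidedIdeal_eq hA hU hJ₂
    rw [toTwoSidedIdeal_inf, toTwoSidedIdeal_inj] at hinf
    rw [toTwoSidedIdeal_inj, toTwoSidedIdeal_inj]
    exact h I₁ I₂ h₁ h₂ hinf

end IsClosedIdeal

/-- The vectors on which a sequence of operators tends to zero. -/
def nullVectors {𝕜 E : Type*} [NontriviallyNormedField 𝕜]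
    [NormedAddCommGroup E] [NormedSpace 𝕜 E] (T : ℕ → E →L[𝕜] E) :
    Submodule 𝕜 E where
  carrier := {v | Tendsto (fun n => T n v) atTop (𝓝 0)}
  zero_mem' := by
    simp only [Set.mem_ofPred_eq, map_zero]
    exact tendsto_const_nhds
  add_mem' {v w} hv hw := by
    have h := Tendsto.add hv hw
    simpa only [Set.mem_ofPred_eq, map_add, add_zero] using h
  smul_mem' c v hv := by
    have h := Tendsto.const_smul hv c
    simpa only [Set.mem_ofPred_eq, map_smul, smul_zero] using h

theorem isClosed_nullVectors {𝕜 E : Type*} [NontriviallyNormedField 𝕜]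
    [NormedAddCommGroup E] [NormedSpace 𝕜 E]
    {T : ℕ → E →L[𝕜] E} {C : ℝ} (hT : ∀ n, ‖T n‖ ≤ C) : IsClosed (nullVectors T : Set E) := by
  have heq : Equicontinuous ((↑) ∘ T : ℕ → E → E) :=
    ((NormedSpace.equicontinuous_TFAE T).out 1 5 :
      Equicontinuous _ ↔ ∃ C, ∀ n, ‖T n‖ ≤ C).2 ⟨C, hT⟩
  exact heq.isClosed_setOfPred_tendsto continuous_const

namespace AFSystem

section RowProjection

variable {𝔄 : Type*} [NonUnitalCStarAlgebra 𝔄] {M : AFSystem 𝔄} {A : NonUnitalSubalgebra ℂ 𝔄}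
  {I I₁ I₂ J : Submodule ℂ 𝔄} {n : ℕ}

theorem mem_of_unit_mem (hA : IsTAF M A) (hU : ∀ n, A.toSubmodule ⊓ M.level n = M.upper n)
    (hI : IsClosedIdeal A I) {S : Submodule ℂ A} (hS : IsClosed (S : Set A))
    (h : ∀ n x y (he : M.unit n x y ∈ A), M.unit n x y ∈ I → ⟨M.unit n x y, he⟩ ∈ S) {a : A}
    (ha : (a : 𝔄) ∈ I) : a ∈ S := by
  have hclosed : IsClosed ((S.map A.toSubmodule.subtype : Submodule ℂ 𝔄) : Set 𝔄) :=
    hA.isClosed.isClosedEmbedding_subtypeVal.isClosedMap _ hS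
  have hle : I ≤ S.map A.toSubmodule.subtype := le_of_unit_mem hA hU hI hclosed fun n x y he =>
    ⟨⟨M.unit n x y, hI.le he⟩, h n x y (hI.le he) he, rfl⟩
  obtain ⟨b, hb, hba⟩ := hle ha
  exact Subtype.ext hba ▸ hb

theorem proj_mul_mem_of_forall_unit (hU : ∀ n, A.toSubmodule ⊓ M.level n = M.upper n)
    (hI : IsClosedIdeal A I) {x : M.Idx n} (h : ∀ y, M.unit n x y ∈ I → M.unit n x y ∈ J) {a : 𝔄}
    (ha : a ∈ I) (han : a ∈ M.level n) : M.proj n x * a ∈ J := by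
  have hsum : M.proj n x * a = ∑ y, M.proj n x * a * M.proj n y := by
    rw [← Finset.mul_sum, mul_assoc]
    exact congrArg _ (mul_one_of_mem han).symm
  rw [hsum]
  refine J.sum_mem fun y _ => ?_
  obtain ⟨c, hc⟩ := exists_corner_of_mem_level han x y
  rw [hc]
  rcases eq_or_ne c 0 with rfl | hc0
  · exact (zero_smul ℂ (M.unit n x y)).symm ▸ J.zero_mem
  · refine J.smul_mem c (h y ((I.smul_mem_iff hc0).1 ?_))
    exact hc ▸ corner_mem hU hI ha x y

theorem unit_mem_of_inf_le (hU : ∀ n, A.toSubmodule ⊓ M.level n = M.upper n)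
    (h₁ : IsClosedIdeal A I₁) (h₂ : IsClosedIdeal A I₂) (hle : I₁ ⊓ I₂ ≤ J) {x y z : M.Idx n}
    (hy : M.unit n x y ∈ I₁) (hz : M.unit n x z ∈ I₂) (hzJ : M.unit n x z ∉ J) :
    M.unit n x y ∈ J := by
  by_cases hxy : x.1 = y.1
  · have hxz : x.1 = z.1 := unit_ne_zero_iff.1 fun h0 => hzJ (h0 ▸ J.zero_mem)
    rcases le_total_of_fst_eq (hxy.symm.trans hxz) with hyz | hzy
    · have hz₁ : M.unit n x z ∈ I₁ := unit_mul_unit (Or.inl hxy) ▸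
        h₁.mul_mem_right _ ((mem_upper_iff hU).1 (unit_mem_upper hyz)).1 _ hy
      exact absurd (hle ⟨hz₁, hz⟩) hzJ
    · have hy₂ : M.unit n x y ∈ I₂ := unit_mul_unit (Or.inl hxz) ▸
        h₂.mul_mem_right _ ((mem_upper_iff hU).1 (unit_mem_upper hzy)).1 _ hz
      exact hle ⟨hy, hy₂⟩
  · exact unit_of_fst_ne hxy ▸ J.zero_mem

open scoped Classical in
/-- The projection of `𝔄ₙ` onto those rows in which every matrix unit of `I` lies in `J`. If
`I ⊓ I' ≤ J`, then modulo `J` it annihilates `I ∩ 𝔄ₙ` and fixes `I' ∩ 𝔄ₙ` from the left. -/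
noncomputable def rowProj (M : AFSystem 𝔄) (n : ℕ) (I J : Submodule ℂ 𝔄) : 𝔄 :=
  ∑ x with ∀ y, M.unit n x y ∈ I → M.unit n x y ∈ J, M.proj n x

theorem rowProj_mem (hU : ∀ n, A.toSubmodule ⊓ M.level n = M.upper n) : M.rowProj n I J ∈ A :=
  A.toSubmodule.sum_mem fun x _ => proj_mem hU x

theorem norm_rowProj_le : ‖M.rowProj n I J‖ ≤ 1 :=
  norm_sum_proj_le _

theorem rowProj_mul_mem (hU : ∀ n, A.toSubmodule ⊓ M.level n = M.upper n)
    (hI : IsClosedIdeal A I) {a : 𝔄} (ha : a ∈ I) (han : a ∈ M.level n) :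
    M.rowProj n I J * a ∈ J := by
  classical
  rw [rowProj, Finset.sum_mul]
  exact J.sum_mem fun x hx =>
    proj_mul_mem_of_forall_unit hU hI (Finset.mem_filter.1 hx).2 ha han

theorem sub_rowProj_mul_mem (hU : ∀ n, A.toSubmodule ⊓ M.level n = M.upper n)
    (h₁ : IsClosedIdeal A I₁) (h₂ : IsClosedIdeal A I₂) (hle : I₁ ⊓ I₂ ≤ J) {a : 𝔄} (ha : a ∈ I₁)
    (han : a ∈ M.level n) : a - M.rowProj n I₂ J * a ∈ J := by
  classical
  have hsum : a - M.rowProj n I₂ J * a =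
      ∑ x with ¬ ∀ y, M.unit n x y ∈ I₂ → M.unit n x y ∈ J, M.proj n x * a := by
    rw [sub_eq_iff_eq_add', rowProj, Finset.sum_mul, Finset.sum_filter_add_sum_filter_not,
      ← Finset.sum_mul]
    exact (one_mul_of_mem han).symm
  rw [hsum]
  refine J.sum_mem fun x hx => proj_mul_mem_of_forall_unit hU h₁ (fun y hy => ?_) ha han
  obtain ⟨z, hz, hzJ⟩ : ∃ z, M.unit n x z ∈ I₂ ∧ M.unit n x z ∉ J := by
    simpa only [not_forall, exists_prop] using (Finset.mem_filter.1 hx).2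
  exact unit_mem_of_inf_le hU h₁ h₂ hle hy hz hzJ

end RowProjection

end AFSystem

section NestRepresentations

variable {𝔄 : Type*} [NonUnitalCStarAlgebra 𝔄] {M : AFSystem 𝔄} {A : NonUnitalSubalgebra ℂ 𝔄}
  {H : Type*} [NormedAddCommGroup H] [InnerProductSpace ℂ H] {π : A →ₙₐ[ℂ] (H →L[ℂ] H)}
  {I I₁ I₂ J : Submodule ℂ 𝔄}

/-- The closed span of `π(I)H`. -/
def essentialSpace (π : A →ₙₐ[ℂ] (H →L[ℂ] H)) (I : Submodule ℂ 𝔄) : Submodule ℂ H :=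
  (Submodule.span ℂ {v | ∃ (b : A) (h : H), (b : 𝔄) ∈ I ∧ v = π b h}).topologicalClosure

theorem apply_mem_essentialSpace {b : A} (hb : (b : 𝔄) ∈ I) (h : H) :
    π b h ∈ essentialSpace π I :=
  Submodule.le_topologicalClosure _ (Submodule.subset_span ⟨b, h, hb, rfl⟩)

theorem essentialSpace_le {V : Submodule ℂ H} (hV : IsClosed (V : Set H))
    (h : ∀ (b : A) (v : H), (b : 𝔄) ∈ I → π b v ∈ V) : essentialSpace π I ≤ V := by
  refine Submodule.topologicalClosure_minimal _ (Submodule.span_le.2 ?_) hV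
  rintro _ ⟨b, v, hb, rfl⟩
  exact h b v hb

theorem map_mem_essentialSpace (hI : IsClosedIdeal A I) (a : A) {v : H}
    (hv : v ∈ essentialSpace π I) : π a v ∈ essentialSpace π I := by
  suffices hle : essentialSpace π I ≤ (essentialSpace π I).comap (π a).toLinearMap from hle hv
  refine essentialSpace_le ((Submodule.isClosed_topologicalClosure _).preimage (π a).continuous)
    fun b w hb => ?_
  change π a (π b w) ∈ essentialSpace π I
  rw [← mul_apply_eq_comp, ← map_mul]
  exact apply_mem_essentialSpace (hI.mul_mem_left a a.2 b hb) w

namespace IsBoundedNestRep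

theorem continuous (hπ : IsBoundedNestRep π) : Continuous π := by
  obtain ⟨C, hC⟩ := hπ.bounded
  exact ((π : A →ₗ[ℂ] (H →L[ℂ] H)).mkContinuous C hC).continuous

theorem isClosed_ker (hπ : IsBoundedNestRep π) : IsClosed (TwoSidedIdeal.ker π : Set A) := by
  have hpre : (TwoSidedIdeal.ker π : Set A) = π ⁻¹' {0} :=
    Set.ext fun _ => TwoSidedIdeal.mem_ker π
  exact hpre ▸ isClosed_singleton.preimage hπ.continuous

end IsBoundedNestRep

theorem essentialSpace_le_nullVectors (hπ : IsBoundedNestRep π) (hA : IsTAF M A)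
    (hU : ∀ n, A.toSubmodule ⊓ M.level n = M.upper n) (hI : IsClosedIdeal A I)
    (hker : ∀ a : A, (a : 𝔄) ∈ J → π a = 0) :
    essentialSpace π I ≤
      nullVectors fun m => π ⟨M.rowProj m I J, AFSystem.rowProj_mem hU⟩ := by
  obtain ⟨C, hC⟩ := hπ.bounded
  have hbound : ∀ m, ‖π ⟨M.rowProj m I J, AFSystem.rowProj_mem hU⟩‖ ≤ |C| := fun m =>
    calc ‖π ⟨M.rowProj m I J, AFSystem.rowProj_mem hU⟩‖
        ≤ C * ‖M.rowProj m I J‖ := hC _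
      _ ≤ |C| * ‖M.rowProj m I J‖ := by gcongr; exact le_abs_self C
      _ ≤ |C| := mul_le_of_le_one_right (abs_nonneg C) AFSystem.norm_rowProj_le
  have hclosed := isClosed_nullVectors hbound
  refine essentialSpace_le hclosed fun b v hb => ?_
  let evalAt : A →ₗ[ℂ] H :=
    (ContinuousLinearMap.apply ℂ H v).toLinearMap ∘ₗ (π : A →ₗ[ℂ] (H →L[ℂ] H))
  have hev : Continuous evalAt := (ContinuousLinearMap.apply ℂ H v).continuous.comp hπ.continuous
  refine AFSystem.mem_of_unit_mem hA hU hI (S := (nullVectors _).comap evalAt)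
    (hclosed.preimage hev) (fun n x y he hxy => ?_) hb
  refine tendsto_const_nhds.congr' (eventually_atTop.2 ⟨n, fun m hnm => Eq.symm ?_⟩)
  have hzero : π (⟨M.rowProj m I J, AFSystem.rowProj_mem hU⟩ * ⟨M.unit n x y, he⟩) = 0 :=
    hker _ (AFSystem.rowProj_mul_mem hU hI hxy
      (AFSystem.level_mono hnm (AFSystem.unit_mem_level x y)))
  change π _ (π _ v) = 0
  rw [← mul_apply_eq_comp, ← map_mul, hzero, zero_apply]

theorem le_of_essentialSpace_le (hπ : IsBoundedNestRep π) (hA : IsTAF M A)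
    (hU : ∀ n, A.toSubmodule ⊓ M.level n = M.upper n) (hJ : IsClosedIdeal A J)
    (hker : ∀ a : A, π a = 0 ↔ (a : 𝔄) ∈ J) (h₁ : IsClosedIdeal A I₁) (h₂ : IsClosedIdeal A I₂)
    (hinf : I₁ ⊓ I₂ ≤ J) (hle : essentialSpace π I₁ ≤ essentialSpace π I₂) : I₁ ≤ J := by
  refine AFSystem.le_of_unit_mem hA hU h₁ hJ.isClosed fun n x y hxy => ?_
  let e : A := ⟨M.unit n x y, h₁.le hxy⟩
  refine (hker e).1 (ContinuousLinearMap.ext fun v => ?_)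
  have hnull := essentialSpace_le_nullVectors hπ hA hU h₂ (fun a => (hker a).2)
    (hle (apply_mem_essentialSpace (b := e) hxy v))
  refine tendsto_nhds_unique (tendsto_const_nhds.congr' (eventually_atTop.2 ⟨n, fun m hnm => ?_⟩))
    hnull
  have hzero : π (e - ⟨M.rowProj m I₂ J, AFSystem.rowProj_mem hU⟩ * e) = 0 :=
    (hker _).2 (AFSystem.sub_rowProj_mul_mem hU h₁ h₂ hinf hxy
      (AFSystem.level_mono hnm (AFSystem.unit_mem_level x y)))
  rw [map_sub, map_mul, sub_eq_zero] at hzero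
  exact congrArg (fun T : H →L[ℂ] H => T v) hzero

theorem IsBoundedNestRep.isMeetIrreducible_ker (hπ : IsBoundedNestRep π)
    (hA : IsStronglyMaximalTAF A) : IsMeetIrreducible (TwoSidedIdeal.ker π) := by
  obtain ⟨M, hM, hU⟩ := hA
  obtain ⟨J, hJ, hJker⟩ := IsClosedIdeal.exists_toTwoSidedIdeal_eq hM hU hπ.isClosed_ker
  have hker : ∀ a : A, π a = 0 ↔ (a : 𝔄) ∈ J := fun a => by
    rw [← hJ.mem_toTwoSidedIdeal, hJker, TwoSidedIdeal.mem_ker]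
  rw [← hJker, hJ.isMeetIrreducible_toTwoSidedIdeal_iff hM hU]
  intro I₁ I₂ h₁ h₂ hinf
  rcases hπ.nest _ _ (Submodule.isClosed_topologicalClosure _)
    (Submodule.isClosed_topologicalClosure _) (fun a _ => map_mem_essentialSpace h₁ a)
    (fun a _ => map_mem_essentialSpace h₂ a) with hle | hle
  · exact Or.inl ((le_of_essentialSpace_le hπ hM hU hJ hker h₁ h₂ hinf.le hle).antisymm
      (hinf.ge.trans inf_le_left))
  · exact Or.inr ((le_of_essentialSpace_le hπ hM hU hJ hker h₂ h₁ (inf_comm I₁ I₂ ▸ hinf.le)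
      hle).antisymm (hinf.ge.trans inf_le_right))

end NestRepresentations

namespace AFSystem

section GeneratedIdeals

variable {𝔄 : Type*} [NonUnitalCStarAlgebra 𝔄] {M : AFSystem 𝔄} {A : NonUnitalSubalgebra ℂ 𝔄}
  {J : Submodule ℂ 𝔄} {n : ℕ} {f : 𝔄}

theorem mul_mem_upper (hU : ∀ n, A.toSubmodule ⊓ M.level n = M.upper n) {a b : 𝔄}
    (ha : a ∈ M.upper n) (hb : b ∈ M.upper n) : a * b ∈ M.upper n := by
  rw [mem_upper_iff hU] at ha hb ⊢
  exact ⟨A.mul_mem ha.1 hb.1, mul_mem_level ha.2 hb.2⟩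

theorem isClosedIdeal_topologicalClosure (hA : IsTAF M A)
    (hU : ∀ n, A.toSubmodule ⊓ M.level n = M.upper n) {S : Submodule ℂ 𝔄} (hS : S ≤ A.toSubmodule)
    (hleft : ∀ n, ∀ a ∈ M.upper n, ∀ b ∈ S, a * b ∈ S)
    (hright : ∀ n, ∀ a ∈ M.upper n, ∀ b ∈ S, b * a ∈ S) :
    IsClosedIdeal A S.topologicalClosure where
  le := S.topologicalClosure_minimal hS hA.isClosed
  isClosed := S.isClosed_topologicalClosure
  mul_mem_left a ha b hb := by
    refine map_mem_closure₂ continuous_mul (hA.limit ha) hb fun a ha b hb => ?_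
    obtain ⟨n, han⟩ := Set.mem_iUnion.1 ha
    exact hleft n a ((mem_upper_iff hU).2 han) b hb
  mul_mem_right a ha b hb := by
    refine map_mem_closure₂ continuous_mul hb (hA.limit ha) fun b hb a ha => ?_
    obtain ⟨n, han⟩ := Set.mem_iUnion.1 ha
    exact hright n a ((mem_upper_iff hU).2 han) b hb

/-- The span of all products `a * f * b` with `a` and `b` in a common `A ∩ 𝔄ₙ`. -/
def sandwichSpan (M : AFSystem 𝔄) (f : 𝔄) : Submodule ℂ 𝔄 :=
  Submodule.span ℂ {g | ∃ n, ∃ a ∈ M.upper n, ∃ b ∈ M.upper n, g = a * f * b}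

/-- The closed ideal of `A` generated by a closed ideal `J` and an element `f` of some
`A ∩ 𝔄ₙ`. -/
def adjoin (M : AFSystem 𝔄) (J : Submodule ℂ 𝔄) (f : 𝔄) : Submodule ℂ 𝔄 :=
  (J ⊔ M.sandwichSpan f).topologicalClosure

theorem le_adjoin : J ≤ M.adjoin J f :=
  le_sup_left.trans (Submodule.le_topologicalClosure _)

theorem mem_adjoin (hU : ∀ n, A.toSubmodule ⊓ M.level n = M.upper n) (hf : f ∈ M.upper n) :
    f ∈ M.adjoin J f := by
  have hone : M.one n ∈ M.upper n := Submodule.sum_mem _ fun x _ => unit_mem_upper le_rfl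
  have hfn : f ∈ M.level n := ((mem_upper_iff hU).1 hf).2
  refine Submodule.le_topologicalClosure _ (Submodule.mem_sup_right (Submodule.subset_span
    ⟨n, M.one n, hone, M.one n, hone, ?_⟩))
  rw [one_mul_of_mem hfn, mul_one_of_mem hfn]

theorem mul_mem_sandwichSpan (hU : ∀ n, A.toSubmodule ⊓ M.level n = M.upper n) {a g : 𝔄}
    (ha : a ∈ M.upper n) (hg : g ∈ M.sandwichSpan f) :
    a * g ∈ M.sandwichSpan f ∧ g * a ∈ M.sandwichSpan f := by
  suffices hle : M.sandwichSpan f ≤ (M.sandwichSpan f).comap (LinearMap.mulLeft ℂ a) ⊓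
      (M.sandwichSpan f).comap (LinearMap.mulRight ℂ a) from hle hg
  refine Submodule.span_le.2 ?_
  rintro _ ⟨m, b, hb, c, hc, rfl⟩
  have hmax {d : 𝔄} (hd : d ∈ M.upper m) : d ∈ M.upper (max n m) :=
    upper_mono hU (le_max_right n m) hd
  have ha' : a ∈ M.upper (max n m) := upper_mono hU (le_max_left n m) ha
  refine ⟨Submodule.subset_span ⟨max n m, a * b, mul_mem_upper hU ha' (hmax hb), c, hmax hc, ?_⟩,
    Submodule.subset_span ⟨max n m, b, hmax hb, c * a, mul_mem_upper hU (hmax hc) ha', ?_⟩⟩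
  · simp only [LinearMap.mulLeft_apply, mul_assoc]
  · simp only [LinearMap.mulRight_apply, mul_assoc]

theorem isClosedIdeal_adjoin (hA : IsTAF M A) (hU : ∀ n, A.toSubmodule ⊓ M.level n = M.upper n)
    (hJ : IsClosedIdeal A J) (hf : f ∈ A) : IsClosedIdeal A (M.adjoin J f) := by
  have hupper : ∀ {n a}, a ∈ M.upper n → a ∈ A := fun ha => ((mem_upper_iff hU).1 ha).1
  refine isClosedIdeal_topologicalClosure hA hU (sup_le hJ.le (Submodule.span_le.2 ?_))
    (fun n a ha h hh => ?_) (fun n a ha h hh => ?_)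
  · rintro _ ⟨n, a, ha, b, hb, rfl⟩
    exact A.mul_mem (A.mul_mem (hupper ha) hf) (hupper hb)
  all_goals
    obtain ⟨j, hj, g, hg, rfl⟩ := Submodule.mem_sup.1 hh
  · rw [mul_add]
    exact Submodule.add_mem_sup (hJ.mul_mem_left a (hupper ha) j hj)
      (mul_mem_sandwichSpan hU ha hg).1
  · rw [add_mul]
    exact Submodule.add_mem_sup (hJ.mul_mem_right a (hupper ha) j hj)
      (mul_mem_sandwichSpan hU ha hg).2

theorem exists_mul_mul_eq_unit_of_corner_ne_zero
    (hU : ∀ n, A.toSubmodule ⊓ M.level n = M.upper n) (hf : f ∈ M.level n) {g : 𝔄}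
    (hg : g ∈ M.sandwichSpan f) : ∃ m₀, ∀ m, m₀ ≤ m → ∀ x y : M.Idx m,
      M.proj m x * g * M.proj m y ≠ 0 →
        ∃ a ∈ M.upper m, ∃ b ∈ M.upper m, a * f * b = M.unit m x y := by
  induction hg using Submodule.span_induction with
  | mem g hg =>
    obtain ⟨k, a, ha, b, hb, rfl⟩ := hg
    refine ⟨max n k, fun m hm x y h0 => ?_⟩
    have hmem {d : 𝔄} (hd : d ∈ M.upper k) : d ∈ M.upper m :=
      upper_mono hU ((le_max_right n k).trans hm) hd
    have hlevel {d : 𝔄} (hd : d ∈ M.upper k) : d ∈ M.level m :=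
      ((mem_upper_iff hU).1 (hmem hd)).2
    obtain ⟨c, hc⟩ := exists_corner_of_mem_level (mul_mem_level (mul_mem_level (hlevel ha)
      (level_mono ((le_max_left n k).trans hm) hf)) (hlevel hb)) x y
    have hc0 : c ≠ 0 := by
      rintro rfl
      exact h0 (hc.trans (zero_smul ℂ _))
    refine ⟨c⁻¹ • (M.proj m x * a), Submodule.smul_mem _ _ (mul_mem_upper hU
      (unit_mem_upper le_rfl) (hmem ha)), b * M.proj m y, mul_mem_upper hU (hmem hb)
      (unit_mem_upper le_rfl), ?_⟩
    rw [smul_mul_assoc, smul_mul_assoc, inv_smul_eq_iff₀ hc0, ← hc]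
    simp only [mul_assoc]
  | zero => exact ⟨0, fun m _ x y h => absurd (by rw [mul_zero, zero_mul]) h⟩
  | add g g' _ _ hg hg' =>
    obtain ⟨m₁, h₁⟩ := hg
    obtain ⟨m₂, h₂⟩ := hg'
    refine ⟨max m₁ m₂, fun m hm x y h0 => ?_⟩
    by_cases hzero : M.proj m x * g * M.proj m y = 0
    · rw [mul_add, add_mul, hzero, zero_add] at h0
      exact h₂ m ((le_max_right m₁ m₂).trans hm) x y h0
    · exact h₁ m ((le_max_left m₁ m₂).trans hm) x y hzero
  | smul c g _ hg =>
    refine hg.imp fun m₀ h m hm x y h0 => h m hm x y fun hz => h0 ?_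
    rw [mul_smul_comm, smul_mul_assoc, hz, smul_zero]

theorem exists_mul_mul_eq_unit_of_mem_adjoin (hA : IsTAF M A)
    (hU : ∀ n, A.toSubmodule ⊓ M.level n = M.upper n) (hJ : IsClosedIdeal A J)
    (hf : f ∈ M.level n) {h : 𝔄} (hh : h ∈ M.adjoin J f) :
    ∃ m₀, ∀ m, m₀ ≤ m → ∀ x y : M.Idx m, M.unit m x y ∉ J →
      M.proj m x * h * M.proj m y = M.unit m x y →
        ∃ a ∈ M.upper m, ∃ b ∈ M.upper m, a * f * b = M.unit m x y := by
  obtain ⟨g₀, hg₀, hdist⟩ := Metric.mem_closure_iff.1 hh (1 / 4) (by norm_num)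
  obtain ⟨j, hj, g, hg, rfl⟩ := Submodule.mem_sup.1 hg₀
  obtain ⟨m₀, hm₀⟩ := exists_mul_mul_eq_unit_of_corner_ne_zero hU hf hg
  refine ⟨m₀, fun m hm x y hxy hcorner => hm₀ m hm x y fun hzero => hxy ?_⟩
  refine unit_mem_of_norm_sub_le hA hU hJ (corner_mem hU hJ hj x y) ?_
  have hdiff : M.unit m x y - M.proj m x * j * M.proj m y =
      M.proj m x * (h - (j + g)) * M.proj m y := by
    rw [mul_sub, sub_mul, mul_add, add_mul, hzero, add_zero, hcorner]
  rw [norm_sub_rev, hdiff]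
  exact (norm_corner_le x y _).trans (dist_eq_norm h (j + g) ▸ hdist.le)

theorem exists_dominated_unit (hA : IsTAF M A) (hU : ∀ n, A.toSubmodule ⊓ M.level n = M.upper n)
    (hJ : IsClosedIdeal A J)
    (hirr : ∀ I₁ I₂, IsClosedIdeal A I₁ → IsClosedIdeal A I₂ → I₁ ⊓ I₂ = J → I₁ = J ∨ I₂ = J)
    {n₁ n₂ : ℕ} {f₁ f₂ : 𝔄} (hf₁ : f₁ ∈ M.upper n₁) (hf₂ : f₂ ∈ M.upper n₂) (hf₁J : f₁ ∉ J)
    (hf₂J : f₂ ∉ J) (N : ℕ) :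
    ∃ m, N ≤ m ∧ ∃ x y : M.Idx m, x ≤ y ∧ M.unit m x y ∉ J ∧
      (∃ a ∈ M.upper m, ∃ b ∈ M.upper m, a * f₁ * b = M.unit m x y) ∧
      ∃ a ∈ M.upper m, ∃ b ∈ M.upper m, a * f₂ * b = M.unit m x y := by
  have hI₁ := isClosedIdeal_adjoin hA hU hJ ((mem_upper_iff hU).1 hf₁).1
  have hI₂ := isClosedIdeal_adjoin hA hU hJ ((mem_upper_iff hU).1 hf₂).1
  obtain ⟨n, s, t, hst, hstJ⟩ : ∃ n s t, M.unit n s t ∈ M.adjoin J f₁ ⊓ M.adjoin J f₂ ∧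
      M.unit n s t ∉ J := by
    by_contra! hsub
    have hinf : M.adjoin J f₁ ⊓ M.adjoin J f₂ = J :=
      (le_of_unit_mem hA hU (hI₁.inf hI₂) hJ.isClosed hsub).antisymm (le_inf le_adjoin le_adjoin)
    rcases hirr _ _ hI₁ hI₂ hinf with h | h
    · exact hf₁J (h ▸ mem_adjoin hU hf₁)
    · exact hf₂J (h ▸ mem_adjoin hU hf₂)
  obtain ⟨m₁, hm₁⟩ :=
    exists_mul_mul_eq_unit_of_mem_adjoin hA hU hJ ((mem_upper_iff hU).1 hf₁).2 hst.1
  obtain ⟨m₂, hm₂⟩ :=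
    exists_mul_mul_eq_unit_of_mem_adjoin hA hU hJ ((mem_upper_iff hU).1 hf₂).2 hst.2
  obtain ⟨m, hm⟩ : ∃ m, m ≥ N ∧ m ≥ n ∧ m ≥ m₁ ∧ m ≥ m₂ :=
    ⟨max (max N n) (max m₁ m₂), by omega, by omega, by omega, by omega⟩
  obtain ⟨x, y, hxy⟩ : ∃ x y, M.proj m x * M.unit n s t * M.proj m y ∉ J := by
    by_contra! hcorner
    rw [eq_sum_corner (unit_mem_level_of_le hm.2.1 s t)] at hstJ
    exact hstJ (J.sum_mem fun p _ => hcorner p.1 p.2)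
  have hcorner : M.proj m x * M.unit n s t * M.proj m y = M.unit m x y :=
    corner_eq_unit hm.2.1 fun h0 => hxy (h0 ▸ J.zero_mem)
  have hxyJ : M.unit m x y ∉ J := hcorner ▸ hxy
  have hxyA : M.unit m x y ∈ A := hcorner ▸ hI₁.le (corner_mem hU hI₁ hst.1 x y)
  refine ⟨m, hm.1, x, y, le_of_unit_mem_upper ?_ ((mem_upper_iff hU).2 ⟨hxyA, unit_mem_level x y⟩),
    hxyJ, hm₁ m hm.2.2.1 x y hxyJ hcorner, hm₂ m hm.2.2.2 x y hxyJ hcorner⟩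
  exact unit_ne_zero_iff.1 fun h0 => hxyJ (h0 ▸ J.zero_mem)

end GeneratedIdeals

section Refinement

variable {𝔄 : Type*} [NonUnitalCStarAlgebra 𝔄] {M : AFSystem 𝔄} {A : NonUnitalSubalgebra ℂ 𝔄}
  {n m : ℕ}

theorem unit_mul_proj_eq_of_common_source {s t x : M.Idx n} {a b y : M.Idx m} (htx : t.1 = x.1)
    (hby : b.1 = y.1) (hs : M.unit n s x * M.proj m y = M.unit m a y)
    (ht : M.unit n t x * M.proj m y = M.unit m b y) :
    M.unit n s t * M.proj m b = M.unit m a b :=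
  calc M.unit n s t * M.proj m b
      = M.unit n s t * (M.unit m b y * M.unit m y b) := by rw [unit_mul_unit (Or.inl hby)]
    _ = M.unit n s t * M.unit n t x * M.proj m y * M.unit m y b := by
      rw [← ht]
      simp only [mul_assoc]
    _ = M.unit m a y * M.unit m y b := by rw [unit_mul_unit (Or.inr htx), hs]
    _ = M.unit m a b := unit_mul_unit (Or.inr hby.symm)

theorem le_of_unit_mul_proj_eq (hU : ∀ n, A.toSubmodule ⊓ M.level n = M.upper n) {s t : M.Idx n}
    {x y : M.Idx m} (hst : s ≤ t) (hxy : x.1 = y.1)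
    (h : M.unit n s t * M.proj m y = M.unit m x y) : x ≤ y := by
  refine le_of_unit_mem_upper hxy ((mem_upper_iff hU).2 ⟨?_, unit_mem_level x y⟩)
  exact h ▸ A.mul_mem ((mem_upper_iff hU).1 (unit_mem_upper hst)).1 (proj_mem hU y)

theorem exists_subunit_of_mul_mul_eq (hnm : n ≤ m) {i j : M.Idx n} {k l : M.Idx m} {a b : 𝔄}
    (hkl : k.1 = l.1) (ha : a ∈ M.upper m) (hb : b ∈ M.upper m)
    (h : a * M.unit n i j * b = M.unit m k l) :
    ∃ u v, k ≤ u ∧ v ≤ l ∧ M.unit n i j * M.proj m v = M.unit m u v := by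
  have hsum : ∑ p : M.Idx m × M.Idx m,
      M.proj m k * (a * (M.proj m p.1 * M.unit n i j * M.proj m p.2) * b) * M.proj m l ≠ 0 := by
    rw [← Finset.sum_mul, ← Finset.mul_sum, ← Finset.sum_mul, ← Finset.mul_sum,
      ← eq_sum_corner (unit_mem_level_of_le hnm i j), h, proj_mul_unit, unit_mul_proj]
    exact unit_ne_zero_iff.2 hkl
  obtain ⟨⟨u, v⟩, -, huv⟩ := Finset.exists_ne_zero_of_sum_ne_zero hsum
  have hassoc : M.proj m k * (a * (M.proj m u * M.unit n i j * M.proj m v) * b) * M.proj m l =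
      M.proj m k * a * M.proj m u * M.unit n i j * (M.proj m v * b * M.proj m l) := by
    simp only [mul_assoc]
  refine ⟨u, v, ?_, ?_, unit_mul_proj_eq hnm fun h0 => huv ?_⟩
  · by_contra hle
    exact huv (by rw [hassoc, corner_eq_zero_of_not_le ha hle, zero_mul, zero_mul])
  · by_contra hle
    exact huv (by rw [hassoc, corner_eq_zero_of_not_le hb hle, mul_zero])
  · rw [h0, mul_zero, zero_mul, mul_zero, zero_mul]

end Refinement

section Cells

variable {𝔄 : Type*} [NonUnitalCStarAlgebra 𝔄] {M : AFSystem 𝔄} {A : NonUnitalSubalgebra ℂ 𝔄}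
  {J : Submodule ℂ 𝔄}

/-- A matrix unit of some `A ∩ 𝔄ₙ`, in row `row` and column `col`, together with a diagonal position
`pos` between them. The interval from `row` to `col` is an interval of the nest to be built, and
`pos` singles out one of its atoms. -/
structure Cell (M : AFSystem 𝔄) where
  level : ℕ
  row : M.Idx level
  col : M.Idx level
  pos : M.Idx level
  row_le_pos : row ≤ pos
  pos_le_col : pos ≤ col

namespace Cell

instance : Countable M.Cell := by
  let F : M.Cell → Σ n : ℕ, M.Idx n × M.Idx n × M.Idx n :=
    fun c => ⟨c.level, c.row, c.col, c.pos⟩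
  refine Function.Injective.countable (f := F) ?_
  rintro ⟨n, i, j, x, _, _⟩ ⟨n', i', j', x', _, _⟩ h
  simp only [F, Sigma.mk.injEq] at h
  obtain ⟨rfl, h⟩ := h
  simp only [heq_eq_eq, Prod.mk.injEq] at h
  obtain ⟨rfl, rfl, rfl⟩ := h
  rfl

/-- The matrix unit of a cell. -/
def unit (c : M.Cell) : 𝔄 := M.unit c.level c.row c.col

/-- The diagonal matrix unit at the distinguished position of a cell. -/
def proj (c : M.Cell) : 𝔄 := M.proj c.level c.pos

theorem unit_mem_upper (c : M.Cell) : c.unit ∈ M.upper c.level :=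
  AFSystem.unit_mem_upper (c.row_le_pos.trans c.pos_le_col)

/-- A cell `c'` refines `c` if its distinguished diagonal matrix unit is a subprojection of that of
`c`, on which the partial isometries taking `pos` into the interval of `c` act as partial isometries
taking the distinguished position of `c'` into the interval of `c'`. -/
structure Refines (c' c : M.Cell) : Prop where
  proj_mul_proj : c.proj * c'.proj = c'.proj
  exists_unit_mul_proj : ∀ s ∈ Set.Icc c.row c.col, ∃ t ∈ Set.Icc c'.row c'.col,
    M.unit c.level s c.pos * c'.proj = M.unit c'.level t c'.pos

theorem exists_refines (hA : IsTAF M A) (hU : ∀ n, A.toSubmodule ⊓ M.level n = M.upper n)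
    (hJ : IsClosedIdeal A J)
    (hirr : ∀ I₁ I₂, IsClosedIdeal A I₁ → IsClosedIdeal A I₂ → I₁ ⊓ I₂ = J → I₁ = J ∨ I₂ = J)
    (c f : M.Cell) (hc : c.unit ∉ J) (hf : f.unit ∉ J) (N : ℕ) :
    ∃ c' : M.Cell, c'.unit ∉ J ∧ N ≤ c'.level ∧ c'.Refines c ∧
      ∃ a ∈ A, ∃ b ∈ A, a * f.unit * b = c'.unit := by
  obtain ⟨n, i, j, x, hix, hxj⟩ := c
  obtain ⟨m, hm, k, l, hkl, hklJ, ⟨a, ha, b, hb, hab⟩, a', ha', b', hb', hab'⟩ :=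
    exists_dominated_unit hA hU hJ hirr (unit_mem_upper _) f.unit_mem_upper hc hf (max N n)
  have hnm : n ≤ m := (le_max_right N n).trans hm
  obtain ⟨u, v, hku, hvl, huv⟩ := exists_subunit_of_mul_mul_eq hnm (fst_eq_of_le hkl) ha hb hab
  have huvl : u.1 = v.1 := (fst_eq_of_le hku).symm.trans
    ((fst_eq_of_le hkl).trans (fst_eq_of_le hvl).symm)
  have htransfer : ∀ s ∈ Set.Icc i j, ∃ t ∈ Set.Icc k l, t.1 = v.1 ∧
      M.unit n s j * M.proj m v = M.unit m t v := by
    rintro s ⟨his, hsj⟩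
    have hne : M.unit n s j * M.proj m v ≠ 0 := fun h0 => by
      have hzero : M.unit n i s * (M.unit n s j * M.proj m v) = M.unit m u v := by
        rw [← mul_assoc, unit_mul_unit (Or.inl (fst_eq_of_le his)), huv]
      exact unit_ne_zero_iff.2 huvl (by rw [← hzero, h0, mul_zero])
    obtain ⟨t, htv, ht⟩ := exists_unit_mul_proj_eq hnm hne
    have hut : u ≤ t := le_of_unit_mul_proj_eq hU his (huvl.trans htv.symm)
      (unit_mul_proj_eq_of_common_source (fst_eq_of_le hsj) htv huv ht)
    exact ⟨t, ⟨hku.trans hut, (le_of_unit_mul_proj_eq hU hsj htv ht).trans hvl⟩, htv, ht⟩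
  obtain ⟨y, ⟨hky, hyl⟩, hyv, hy⟩ := htransfer x ⟨hix, hxj⟩
  have hA' : ∀ {d}, d ∈ M.upper m → d ∈ A := fun hd => ((mem_upper_iff hU).1 hd).1
  refine ⟨⟨m, k, l, y, hky, hyl⟩, hklJ, (le_max_left N n).trans hm, ⟨?_, fun s hs => ?_⟩,
    a', hA' ha', b', hA' hb', hab'⟩
  · exact unit_mul_proj_eq_of_common_source (fst_eq_of_le hxj) hyv hy hy
  · obtain ⟨t, ht, -, hts⟩ := htransfer s hs
    exact ⟨t, ht, unit_mul_proj_eq_of_common_source (fst_eq_of_le hxj) hyv hts hy⟩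

theorem exists_seq (hA : IsTAF M A) (hU : ∀ n, A.toSubmodule ⊓ M.level n = M.upper n)
    (hJ : IsClosedIdeal A J)
    (hirr : ∀ I₁ I₂, IsClosedIdeal A I₁ → IsClosedIdeal A I₂ → I₁ ⊓ I₂ = J → I₁ = J ∨ I₂ = J)
    (hne : ∃ c : M.Cell, c.unit ∉ J) :
    ∃ c : ℕ → M.Cell, (∀ k, (c k).unit ∉ J) ∧ (∀ k, k ≤ (c k).level) ∧
      (∀ k, (c (k + 1)).Refines (c k)) ∧
      ∀ f : M.Cell, f.unit ∉ J → ∃ k, ∃ a ∈ A, ∃ b ∈ A, a * f.unit * b = (c k).unit := by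
  let T := {c : M.Cell // c.unit ∉ J}
  obtain ⟨c₀, hc₀⟩ := hne
  have : Nonempty T := ⟨⟨c₀, hc₀⟩⟩
  obtain ⟨f, hf⟩ := exists_surjective_nat T
  have hstep : ∀ (k : ℕ) (c : T), ∃ c' : T, k + 1 ≤ c'.1.level ∧ c'.1.Refines c.1 ∧
      ∃ a ∈ A, ∃ b ∈ A, a * (f k).1.unit * b = c'.1.unit := fun k c => by
    obtain ⟨c', hc', h⟩ := exists_refines hA hU hJ hirr c.1 (f k).1 c.2 (f k).2 (k + 1)
    exact ⟨⟨c', hc'⟩, h⟩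
  choose next hlevel hrefines hdom using hstep
  let c : ℕ → T := fun k => Nat.rec ⟨c₀, hc₀⟩ next k
  refine ⟨fun k => (c k).1, fun k => (c k).2, fun k => ?_, fun k => hrefines k (c k),
    fun g hg => ?_⟩
  · cases k with
    | zero => exact Nat.zero_le _
    | succ k => exact hlevel k (c k)
  · obtain ⟨k, hk⟩ := hf ⟨g, hg⟩
    have hgk := hdom k (c k)
    rw [hk] at hgk
    exact ⟨k + 1, hgk⟩

end Cell

end Cells

end AFSystem

section GNS

variable {𝔄 : Type*} [NonUnitalCStarAlgebra 𝔄]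

theorem norm_eq_one_of_isStarProjection {q : 𝔄} (hq : IsStarProjection q) (h0 : q ≠ 0) :
    ‖q‖ = 1 := by
  have h := CStarRing.norm_star_mul_self (x := q)
  rw [hq.isSelfAdjoint.star_eq, hq.isIdempotentElem] at h
  exact (mul_eq_left₀ (norm_ne_zero_iff.2 h0)).1 h.symm

theorem exists_ultrafilter_limit_strongDual {ι E : Type*} [NormedAddCommGroup E] [NormedSpace ℂ E]
    (l : Ultrafilter ι) {ψ : ι → StrongDual ℂ E} {C : ℝ} (hψ : ∀ i, ‖ψ i‖ ≤ C) :
    ∃ φ : StrongDual ℂ E, ∀ a, Tendsto (fun i => ψ i a) l (𝓝 (φ a)) := by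
  obtain ⟨φ, -, hφ⟩ := (WeakDual.isCompact_closedBall (0 : StrongDual ℂ E) C).ultrafilter_le_nhds
    (l.map fun i => StrongDual.toWeakDual (ψ i))
    (le_principal_iff.2 (mem_map.2 (Eventually.of_forall fun i =>
      mem_closedBall_zero_iff.2 (hψ i))))
  exact ⟨WeakDual.toStrongDual φ, fun a => ((WeakDual.eval_continuous a).tendsto φ).comp hφ⟩

open scoped ComplexOrder

variable [PartialOrder 𝔄] [StarOrderedRing 𝔄]

theorem nonneg_of_smul_nonneg_of_pos {q : 𝔄} (hq : 0 < q) {c : ℂ} (hc : 0 ≤ c • q) : 0 ≤ c := by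
  have hreal : star c = c := by
    have h := (IsSelfAdjoint.of_nonneg hc).star_eq
    rw [star_smul, (IsSelfAdjoint.of_nonneg hq.le).star_eq] at h
    exact smul_left_injective ℂ hq.ne' h
  obtain ⟨r, rfl⟩ := Complex.conj_eq_iff_real.1 hreal
  rw [Complex.coe_smul] at hc
  rw [Complex.zero_le_real]
  by_contra! hr
  have hneg : 0 ≤ (-r) • q := smul_nonneg (neg_nonneg.2 hr.le) hq.le
  rw [neg_smul, Left.nonneg_neg_iff] at hneg
  exact (smul_ne_zero hr.ne hq.ne') (le_antisymm hneg hc)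

/-- Compressing to `q k` is, on `D`, eventually the same as applying a state, so the limit of the
compressions along an ultrafilter is a positive functional. -/
theorem exists_positiveLinearMap_eq_one {q : ℕ → 𝔄} (hq : ∀ k, IsStarProjection (q k))
    (h0 : ∀ k, q k ≠ 0) (hdec : ∀ k m, k ≤ m → q k * q m = q m) {D : Set 𝔄} (hD : Dense D)
    (hmin : ∀ a ∈ D, ∀ᶠ k in atTop, ∃ c : ℂ, q k * (star a * a) * q k = c • q k) :
    ∃ f : 𝔄 →ₚ[ℂ] ℂ, ∀ k, f (q k) = 1 := by
  have hnorm k : ‖q k‖ = 1 := norm_eq_one_of_isStarProjection (hq k) (h0 k)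
  choose ψ hψ hψq using fun k => exists_dual_vector ℂ (q k) (norm_ne_zero_iff.2 (h0 k))
  simp only [hnorm, RCLike.ofReal_one] at hψq
  have hbound k : ‖(ψ k).comp (ContinuousLinearMap.mulLeftRight ℂ 𝔄 (q k) (q k))‖ ≤ 1 := by
    refine (ContinuousLinearMap.opNorm_comp_le _ _).trans ?_
    rw [hψ, one_mul]
    refine (ContinuousLinearMap.opNorm_mulLeftRight_apply_apply_le ℂ 𝔄 (q k) (q k)).trans ?_
    rw [hnorm, one_mul]
  obtain ⟨φ, hφ⟩ := exists_ultrafilter_limit_strongDual (hyperfilter ℕ) hbound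
  simp only [ContinuousLinearMap.comp_apply, ContinuousLinearMap.mulLeftRight_apply] at hφ
  have hφD : ∀ a ∈ D, 0 ≤ φ (star a * a) := fun a ha => by
    refine ge_of_tendsto (hφ _) ?_
    filter_upwards [Nat.hyperfilter_le_atTop (hmin a ha)] with k ⟨c, hc⟩
    rw [hc, map_smul, hψq, smul_eq_mul, mul_one]
    refine nonneg_of_smul_nonneg_of_pos ((hq k).nonneg.lt_of_ne' (h0 k)) (hc ▸ ?_)
    exact (hq k).isSelfAdjoint.conjugate_nonneg (star_mul_self_nonneg a)
  have hφ_nonneg (a : 𝔄) : 0 ≤ φ (star a * a) :=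
    (isClosed_le continuous_const (φ.continuous.comp
      (continuous_star.mul continuous_id))).closure_subset_iff.2 hφD (hD a)
  refine ⟨PositiveLinearMap.mk₀ φ.toLinearMap fun a ha => ?_, fun k => ?_⟩
  · obtain ⟨b, rfl⟩ := CStarAlgebra.nonneg_iff_eq_star_mul_self.1 ha
    exact hφ_nonneg b
  · refine tendsto_nhds_unique (hφ (q k)) (tendsto_const_nhds.congr' ?_)
    filter_upwards [Nat.hyperfilter_le_atTop (eventually_ge_atTop k)] with m hm
    have hmk : q m * q k = q m := by
      simpa [(hq _).isSelfAdjoint.star_eq] using congrArg star (hdec k m hm)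
    rw [hmk, (hq m).isIdempotentElem, hψq]

theorem gnsNonUnitalStarAlgHom_apply_toPreGNS_eq (f : 𝔄 →ₚ[ℂ] ℂ) {p q : 𝔄}
    (hp : IsStarProjection p) (hq : IsStarProjection q) (hpq : p * q = q) (h : f q = f p) :
    f.gnsNonUnitalStarAlgHom q ((f.toPreGNS p : f.PreGNS) : f.GNS) =
      ((f.toPreGNS p : f.PreGNS) : f.GNS) := by
  have hqp : q * p = q := by
    simpa [hp.isSelfAdjoint.star_eq, hq.isSelfAdjoint.star_eq] using congrArg star hpq
  have hsub : star (q - p) * (q - p) = p - q := by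
    rw [star_sub, hp.isSelfAdjoint.star_eq, hq.isSelfAdjoint.star_eq, sub_mul, mul_sub, mul_sub,
      hp.isIdempotentElem, hq.isIdempotentElem, hpq, hqp]
    abel
  rw [PositiveLinearMap.gnsNonUnitalStarAlgHom_apply_coe, ← sub_eq_zero,
    ← UniformSpace.Completion.coe_sub, ← norm_eq_zero, UniformSpace.Completion.norm_coe,
    PositiveLinearMap.leftMulMapPreGNS_apply, f.ofPreGNS_toPreGNS, hqp, ← map_sub,
    f.preGNS_norm_def, f.ofPreGNS_toPreGNS, hsub, map_sub, h, sub_self, Complex.zero_re,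
    Real.sqrt_zero]

end GNS

theorem exists_rep_fixed_vector_of_isStarProjection {𝔄 : Type u} [NonUnitalCStarAlgebra 𝔄]
    {q : ℕ → 𝔄} (hq : ∀ k, IsStarProjection (q k)) (h0 : ∀ k, q k ≠ 0)
    (hdec : ∀ k m, k ≤ m → q k * q m = q m) {D : Set 𝔄} (hD : Dense D)
    (hmin : ∀ a ∈ D, ∀ᶠ k in atTop, ∃ c : ℂ, q k * (star a * a) * q k = c • q k) :
    ∃ (K : Type u) (_ : NormedAddCommGroup K) (_ : InnerProductSpace ℂ K) (_ : CompleteSpace K)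
      (π : 𝔄 →⋆ₙₐ[ℂ] (K →L[ℂ] K)) (ξ : K), ‖ξ‖ = 1 ∧ ∀ k, π (q k) ξ = ξ := by
  let _ := CStarAlgebra.spectralOrder 𝔄
  have _ := CStarAlgebra.spectralOrderedRing 𝔄
  obtain ⟨f, hf⟩ := exists_positiveLinearMap_eq_one hq h0 hdec hD hmin
  refine ⟨f.GNS, inferInstance, inferInstance, inferInstance, f.gnsNonUnitalStarAlgHom,
    ((f.toPreGNS (q 0) : f.PreGNS) : f.GNS), ?_, fun k => ?_⟩
  · rw [UniformSpace.Completion.norm_coe, f.preGNS_norm_def, f.ofPreGNS_toPreGNS,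
      (hq 0).isSelfAdjoint.star_eq, (hq 0).isIdempotentElem, hf, Complex.one_re, Real.sqrt_one]
  · exact gnsNonUnitalStarAlgHom_apply_toPreGNS_eq f (hq 0) (hq k) (hdec 0 k k.zero_le)
      ((hf k).trans (hf 0).symm)

namespace AFSystem

theorem exists_mem_level_of_mem_span {𝔄 : Type*} [NonUnitalCStarAlgebra 𝔄] {M : AFSystem 𝔄} {a : 𝔄}
    (ha : a ∈ Submodule.span ℂ {x : 𝔄 | ∃ n r i j, x = M.e n r i j}) : ∃ n, a ∈ M.level n := by
  induction ha using Submodule.span_induction with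
  | mem x h => exact h.imp fun n hn => Submodule.subset_span hn
  | zero => exact ⟨0, zero_mem _⟩
  | add x y _ _ hx hy =>
    obtain ⟨n, hn⟩ := hx
    obtain ⟨m, hm⟩ := hy
    exact ⟨max n m, add_mem (level_mono (le_max_left _ _) hn) (level_mono (le_max_right _ _) hm)⟩
  | smul c x _ hx => exact hx.imp fun n hn => Submodule.smul_mem _ c hn

theorem Cell.proj_mul_proj_of_le {𝔄 : Type*} [NonUnitalCStarAlgebra 𝔄] {M : AFSystem 𝔄}
    {c : ℕ → M.Cell} (hc : ∀ k, (c (k + 1)).Refines (c k)) {k m : ℕ} (hkm : k ≤ m) :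
    (c k).proj * (c m).proj = (c m).proj := by
  induction m, hkm using Nat.le_induction with
  | base => exact proj_mul_unit _ _
  | succ m _ ih => rw [← (hc m).proj_mul_proj, ← mul_assoc, ih]

theorem Cell.exists_rep_fixed_vector {𝔄 : Type u} [NonUnitalCStarAlgebra 𝔄] {M : AFSystem 𝔄}
    {c : ℕ → M.Cell} (hlevel : ∀ k, k ≤ (c k).level) (hc : ∀ k, (c (k + 1)).Refines (c k)) :
    ∃ (K : Type u) (_ : NormedAddCommGroup K) (_ : InnerProductSpace ℂ K) (_ : CompleteSpace K)
      (π : 𝔄 →⋆ₙₐ[ℂ] (K →L[ℂ] K)) (ξ : K), ‖ξ‖ = 1 ∧ ∀ k, π (c k).proj ξ = ξ := by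
  refine exists_rep_fixed_vector_of_isStarProjection (fun k => isStarProjection_proj _)
    (fun k => proj_ne_zero _) (fun k m hkm => proj_mul_proj_of_le hc hkm) M.dense_span
    fun a ha => ?_
  obtain ⟨n, hna⟩ := exists_mem_level_of_mem_span ha
  filter_upwards [eventually_ge_atTop n] with k hk
  have hl := level_mono (hk.trans (hlevel k)) hna
  exact exists_corner_of_mem_level (mul_mem_level (star_mem_level hl) hl) _ _

end AFSystem

section Compression

variable {K : Type*} [NormedAddCommGroup K] [InnerProductSpace ℂ K]

/-- The compression of an operator to a subspace, as a linear map between spaces of operators. -/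
noncomputable def compression (L : Submodule ℂ K) [L.HasOrthogonalProjection] :
    (K →L[ℂ] K) →L[ℂ] (L →L[ℂ] L) :=
  (ContinuousLinearMap.compL ℂ L K L L.orthogonalProjectionOnto) ∘L
    (ContinuousLinearMap.compL ℂ L K K).flip L.subtypeL

section

variable (L : Submodule ℂ K) [L.HasOrthogonalProjection]

theorem coe_compression_apply (T : K →L[ℂ] K) (x : L) :
    (compression L T x : K) = L.starProjection (T x) :=
  rfl

theorem inner_compression_apply (T : K →L[ℂ] K) (x y : L) :
    ⟪y, compression L T x⟫_ℂ = ⟪(y : K), T x⟫_ℂ := by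
  rw [Submodule.coe_inner, coe_compression_apply, ← Submodule.inner_starProjection_left_eq_right,
    Submodule.starProjection_eq_self_iff.2 y.2]

theorem norm_compression_le (T : K →L[ℂ] K) : ‖compression L T‖ ≤ ‖T‖ := by
  refine ContinuousLinearMap.opNorm_le_bound _ (norm_nonneg T) fun x => ?_
  exact (L.norm_orthogonalProjectionOnto_apply_le (T x)).trans (T.le_opNorm x)

theorem compression_comp_starProjection_comp (S T : K →L[ℂ] K) :
    compression L (S ∘L L.starProjection ∘L T) = compression L S * compression L T :=
  rfl

end

variable {U : ℕ → Submodule ℂ K}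

theorem exists_mem_of_mem_iSup (hU : Monotone U) {x : K} (hx : x ∈ ⨆ k, U k) : ∃ k, x ∈ U k :=
  (Submodule.mem_iSup_of_directed U hU.directed_le).1 hx

theorem compression_eq_zero [(⨆ k, U k).topologicalClosure.HasOrthogonalProjection]
    (hU : Monotone U) {T : K →L[ℂ] K} (hT : ∀ k, ∀ x ∈ U k, ∀ y ∈ U k, ⟪y, T x⟫_ℂ = 0) :
    compression (⨆ k, U k).topologicalClosure T = 0 := by
  have hy : ∀ x ∈ ⨆ k, U k, ∀ y ∈ (⨆ k, U k).topologicalClosure, ⟪y, T x⟫_ℂ = 0 := by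
    intro x hx
    refine closure_minimal (fun y hy => ?_) (isClosed_eq (by fun_prop) continuous_const)
    obtain ⟨k, hk⟩ := exists_mem_of_mem_iSup hU hx
    obtain ⟨m, hm⟩ := exists_mem_of_mem_iSup hU hy
    exact hT (max k m) x (hU (le_max_left k m) hk) y (hU (le_max_right k m) hm)
  ext x : 1
  refine ext_inner_left ℂ fun y => ?_
  rw [inner_compression_apply, zero_apply, inner_zero_right]
  exact closure_minimal (fun x hx => hy x hx y y.2)
    (isClosed_eq (by fun_prop) continuous_const) x.2

end Compression

namespace AFSystem

namespace Cell

section Vectors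

variable {𝔄 : Type*} [NonUnitalCStarAlgebra 𝔄] {M : AFSystem 𝔄} {A : NonUnitalSubalgebra ℂ 𝔄}
  {K : Type*} [NormedAddCommGroup K] [InnerProductSpace ℂ K] [CompleteSpace K]
  (π : 𝔄 →⋆ₙₐ[ℂ] (K →L[ℂ] K)) (ξ : K)

/-- The images of `ξ`, regarded as a vector at the distinguished position of a cell, under the
matrix units taking that position to the others. -/
noncomputable def vec (c : M.Cell) (s : M.Idx c.level) : K := π (M.unit c.level s c.pos) ξ

/-- The span of the vectors at the positions in the interval of a cell. -/
noncomputable def space (c : M.Cell) : Submodule ℂ K :=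
  Submodule.span ℂ (c.vec π ξ '' Set.Icc c.row c.col)

/-- The span of the vectors at the positions not in or above the interval of a cell. It is
invariant, like its sum with `space`. -/
noncomputable def spaceBelow (c : M.Cell) : Submodule ℂ K :=
  Submodule.span ℂ (c.vec π ξ '' {s | ¬c.row ≤ s})

instance (c : M.Cell) : FiniteDimensional ℂ (c.space π ξ) :=
  FiniteDimensional.span_of_finite ℂ ((Set.Icc c.row c.col).toFinite.image _)

variable {π ξ} {c : M.Cell}

theorem fst_eq_pos_of_mem_Icc {s : M.Idx c.level} (hs : s ∈ Set.Icc c.row c.col) :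
    s.1 = c.pos.1 :=
  (fst_eq_of_le hs.1).symm.trans (fst_eq_of_le c.row_le_pos)

theorem vec_mem_space {s : M.Idx c.level} (hs : s ∈ Set.Icc c.row c.col) :
    c.vec π ξ s ∈ c.space π ξ :=
  Submodule.subset_span (Set.mem_image_of_mem _ hs)

theorem apply_unit_vec {s t : M.Idx c.level} (h : t.1 = s.1) :
    π (M.unit c.level t s) (c.vec π ξ s) = c.vec π ξ t := by
  rw [vec, ← mul_apply_eq_comp, ← map_mul, unit_mul_unit (Or.inl h), vec]

theorem apply_unit_vec_of_ne (t : M.Idx c.level) {s u : M.Idx c.level} (h : s ≠ u) :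
    π (M.unit c.level t s) (c.vec π ξ u) = 0 := by
  rw [vec, ← mul_apply_eq_comp, ← map_mul, unit_mul_unit_of_ne _ _ h, map_zero,
    zero_apply]

theorem inner_vec_left (s : M.Idx c.level) (y : K) :
    ⟪c.vec π ξ s, y⟫_ℂ = ⟪ξ, π (M.unit c.level c.pos s) y⟫_ℂ := by
  rw [vec, ← star_unit, map_star, ContinuousLinearMap.star_eq_adjoint,
    ContinuousLinearMap.adjoint_inner_left]

theorem inner_vec_of_ne {s t : M.Idx c.level} (h : s ≠ t) :
    ⟪c.vec π ξ s, c.vec π ξ t⟫_ℂ = 0 := by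
  rw [inner_vec_left, apply_unit_vec_of_ne _ h, inner_zero_right]

theorem inner_vec_self (hξ : ‖ξ‖ = 1) (hc : π c.proj ξ = ξ) {s : M.Idx c.level}
    (hs : s ∈ Set.Icc c.row c.col) : ⟪c.vec π ξ s, c.vec π ξ s⟫_ℂ = 1 := by
  rw [inner_vec_left, apply_unit_vec (fst_eq_pos_of_mem_Icc hs).symm, vec,
    show π (M.unit c.level c.pos c.pos) ξ = ξ from hc, inner_self_eq_norm_sq_to_K, hξ,
    RCLike.ofReal_one, one_pow]

theorem apply_proj_of_mem_space (hξ : ‖ξ‖ = 1) (hc : π c.proj ξ = ξ) {s : M.Idx c.level}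
    (hs : s ∈ Set.Icc c.row c.col) {y : K} (hy : y ∈ c.space π ξ) :
    π (M.proj c.level s) y = ⟪c.vec π ξ s, y⟫_ℂ • c.vec π ξ s := by
  induction hy using Submodule.span_induction with
  | mem y hy =>
    obtain ⟨t, -, rfl⟩ := hy
    by_cases hst : s = t
    · rw [← hst, apply_unit_vec rfl, inner_vec_self hξ hc hs, one_smul]
    · rw [apply_unit_vec_of_ne _ hst, inner_vec_of_ne hst, zero_smul]
  | zero => rw [map_zero, inner_zero_right, zero_smul]
  | add y z _ _ hy hz => rw [map_add, hy, hz, inner_add_right, add_smul]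
  | smul a y _ hy => rw [map_smul, hy, inner_smul_right, mul_smul]

theorem apply_vec_mem_span_of_mem_upper {a : 𝔄} (ha : a ∈ M.upper c.level) (t : M.Idx c.level) :
    π a (c.vec π ξ t) ∈ Submodule.span ℂ (c.vec π ξ '' Set.Iic t) := by
  rw [upper_eq_span] at ha
  induction ha using Submodule.span_induction with
  | mem a ha =>
    obtain ⟨i, j, hij, rfl⟩ := ha
    by_cases hjt : j = t
    · rw [← hjt, apply_unit_vec (fst_eq_of_le hij)]
      exact Submodule.subset_span (Set.mem_image_of_mem _ hij)
    · rw [apply_unit_vec_of_ne _ hjt]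
      exact zero_mem _
  | zero => simp
  | add a b _ _ ha hb => rw [map_add]; exact add_mem ha hb
  | smul z a _ ha => rw [map_smul]; exact Submodule.smul_mem _ _ ha

theorem apply_mem_spaceBelow {a : 𝔄} (ha : a ∈ M.upper c.level) {y : K}
    (hy : y ∈ c.spaceBelow π ξ) : π a y ∈ c.spaceBelow π ξ := by
  suffices h : c.spaceBelow π ξ ≤ (c.spaceBelow π ξ).comap (π a).toLinearMap from h hy
  refine Submodule.span_le.2 ?_
  rintro _ ⟨t, ht, rfl⟩
  refine Submodule.span_mono (Set.image_mono fun s hst => ?_) (apply_vec_mem_span_of_mem_upper ha t)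
  exact fun hs => ht (hs.trans hst)

theorem apply_mem_space_sup_spaceBelow {a : 𝔄} (ha : a ∈ M.upper c.level) {y : K}
    (hy : y ∈ c.space π ξ) : π a y ∈ c.space π ξ ⊔ c.spaceBelow π ξ := by
  suffices h : c.space π ξ ≤ (c.space π ξ ⊔ c.spaceBelow π ξ).comap (π a).toLinearMap from h hy
  refine Submodule.span_le.2 ?_
  rintro _ ⟨t, ht, rfl⟩
  rw [space, spaceBelow, ← Submodule.span_union, ← Set.image_union]
  refine Submodule.span_mono (Set.image_mono fun s hst => ?_) (apply_vec_mem_span_of_mem_upper ha t)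
  by_cases hs : c.row ≤ s
  · exact Or.inl ⟨hs, le_trans hst ht.2⟩
  · exact Or.inr hs

theorem inner_eq_zero_of_mem_spaceBelow {x y : K} (hx : x ∈ c.space π ξ)
    (hy : y ∈ c.spaceBelow π ξ) : ⟪x, y⟫_ℂ = 0 := by
  suffices h : c.space π ξ ⟂ c.spaceBelow π ξ from h.inner_eq hx hy
  refine Submodule.isOrtho_span.2 ?_
  rintro _ ⟨s, hs, rfl⟩ _ ⟨t, ht, rfl⟩
  exact inner_vec_of_ne fun hst => ht (hst ▸ hs.1)

/-- Applying `π b` moves `x` only within `space` and into `spaceBelow`, and the latter component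
stays orthogonal to `space` under `π a`. -/
theorem inner_apply_starProjection_apply {a b : 𝔄} (ha : a ∈ M.upper c.level)
    (hb : b ∈ M.upper c.level) {x y : K} (hx : x ∈ c.space π ξ) (hy : y ∈ c.space π ξ) :
    ⟪y, π a ((c.space π ξ).starProjection (π b x))⟫_ℂ = ⟪y, π a (π b x)⟫_ℂ := by
  obtain ⟨u, hu, w, hw, huw⟩ := Submodule.mem_sup.1 (apply_mem_space_sup_spaceBelow hb hx)
  have hproj : (c.space π ξ).starProjection w = 0 :=
    (Submodule.starProjection_apply_eq_zero_iff _).2 fun v hv =>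
      inner_eq_zero_of_mem_spaceBelow hv hw
  rw [← huw, map_add, hproj, add_zero, Submodule.starProjection_eq_self_iff.2 hu, map_add,
    inner_add_right, inner_eq_zero_of_mem_spaceBelow hy (apply_mem_spaceBelow ha hw), add_zero]

theorem corner_eq_zero_of_mem (hU : ∀ n, A.toSubmodule ⊓ M.level n = M.upper n)
    {J : Submodule ℂ 𝔄} (hJ : IsClosedIdeal A J) (hcJ : c.unit ∉ J) {a : 𝔄} (ha : a ∈ J)
    (hal : a ∈ M.level c.level) {s t : M.Idx c.level} (hs : c.row ≤ s) (ht : t ≤ c.col) :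
    M.proj c.level s * a * M.proj c.level t = 0 := by
  obtain ⟨z, hz⟩ := exists_corner_of_mem_level hal s t
  by_contra hne
  rw [hz, smul_eq_zero, not_or] at hne
  have hst : M.unit c.level s t ∈ J :=
    (Submodule.smul_mem_iff _ hne.1).1 (hz ▸ corner_mem hU hJ ha s t)
  have hA {u v : M.Idx c.level} (h : u ≤ v) : M.unit c.level u v ∈ A :=
    ((mem_upper_iff hU).1 (AFSystem.unit_mem_upper h)).1
  have hunit := hJ.mul_mem_right _ (hA ht) _ (hJ.mul_mem_left _ (hA hs) _ hst)
  rw [unit_mul_unit (Or.inl (fst_eq_of_le hs)), unit_mul_unit (Or.inr (fst_eq_of_le ht))] at hunit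
  exact hcJ hunit

theorem inner_apply_eq_zero_of_mem (hU : ∀ n, A.toSubmodule ⊓ M.level n = M.upper n)
    {J : Submodule ℂ 𝔄} (hJ : IsClosedIdeal A J) (hcJ : c.unit ∉ J) {a : 𝔄} (ha : a ∈ J)
    (hal : a ∈ M.level c.level) {x y : K} (hx : x ∈ c.space π ξ) (hy : y ∈ c.space π ξ) :
    ⟪y, π a x⟫_ℂ = 0 := by
  suffices h : c.space π ξ ⟂ (c.space π ξ).map (π a).toLinearMap from
    h.inner_eq hy (Submodule.mem_map_of_mem hx)
  rw [space, Submodule.map_span, ← Set.image_comp, Submodule.isOrtho_span]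
  rintro _ ⟨s, hs, rfl⟩ _ ⟨t, ht, rfl⟩
  have hcorner : M.unit c.level c.pos s * a * M.proj c.level t = 0 := by
    rw [← unit_mul_proj, mul_assoc (M.unit c.level c.pos s), mul_assoc (M.unit c.level c.pos s),
      corner_eq_zero_of_mem hU hJ hcJ ha hal hs.1 ht.2, mul_zero]
  calc ⟪c.vec π ξ s, π a (c.vec π ξ t)⟫_ℂ
      = ⟪ξ, π (M.unit c.level c.pos s * a * M.proj c.level t) (c.vec π ξ t)⟫_ℂ := by
        rw [inner_vec_left, map_mul, map_mul, mul_apply_eq_comp, mul_apply_eq_comp,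
          apply_unit_vec rfl]
    _ = 0 := by rw [hcorner, map_zero, zero_apply, inner_zero_right]

theorem Refines.exists_vec_eq {c' : M.Cell} (h : c'.Refines c) (hξ : π c'.proj ξ = ξ)
    {s : M.Idx c.level} (hs : s ∈ Set.Icc c.row c.col) :
    ∃ t ∈ Set.Icc c'.row c'.col, c.vec π ξ s = c'.vec π ξ t := by
  obtain ⟨t, ht, hst⟩ := h.exists_unit_mul_proj s hs
  refine ⟨t, ht, ?_⟩
  rw [vec, vec, ← hst, map_mul, mul_apply_eq_comp, hξ]

end Vectors

section LimitSpace

variable {𝔄 : Type*} [NonUnitalCStarAlgebra 𝔄] {M : AFSystem 𝔄} {A : NonUnitalSubalgebra ℂ 𝔄}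
  {K : Type*} [NormedAddCommGroup K] [InnerProductSpace ℂ K] [CompleteSpace K]

/-- `ξ` is a unit vector fixed by the distinguished projections of a refining sequence of cells:
the vector to be thought of as sitting at the limit of the distinguished positions. -/
structure IsLimitVector (π : 𝔄 →⋆ₙₐ[ℂ] (K →L[ℂ] K)) (ξ : K) (c : ℕ → M.Cell) : Prop where
  norm_eq_one : ‖ξ‖ = 1
  apply_proj : ∀ k, π (c k).proj ξ = ξ
  refines : ∀ k, (c (k + 1)).Refines (c k)
  le_level : ∀ k, k ≤ (c k).level

/-- The Hilbert space of the nest representation: the closed span of the vectors at the positions in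
the intervals of the cells. -/
noncomputable def limitSpace (π : 𝔄 →⋆ₙₐ[ℂ] (K →L[ℂ] K)) (ξ : K) (c : ℕ → M.Cell) :
    Submodule ℂ K :=
  (⨆ k, (c k).space π ξ).topologicalClosure

variable {π : 𝔄 →⋆ₙₐ[ℂ] (K →L[ℂ] K)} {ξ : K} {c : ℕ → M.Cell}

instance : CompleteSpace (limitSpace π ξ c) :=
  inferInstanceAs (CompleteSpace (Submodule.topologicalClosure _))

namespace IsLimitVector

variable (h : IsLimitVector π ξ c)
include h

theorem exists_vec_eq {k m : ℕ} (hkm : k ≤ m) {s : M.Idx (c k).level}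
    (hs : s ∈ Set.Icc (c k).row (c k).col) :
    ∃ t ∈ Set.Icc (c m).row (c m).col, (c k).vec π ξ s = (c m).vec π ξ t := by
  induction m, hkm using Nat.le_induction with
  | base => exact ⟨s, hs, rfl⟩
  | succ m _ ih =>
    obtain ⟨t, ht, hst⟩ := ih
    obtain ⟨u, hu, htu⟩ := (h.refines m).exists_vec_eq (h.apply_proj _) ht
    exact ⟨u, hu, hst.trans htu⟩

theorem monotone_space : Monotone fun k => (c k).space π ξ := fun k m hkm => by
  refine Submodule.span_le.2 ?_
  rintro _ ⟨s, hs, rfl⟩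
  obtain ⟨t, ht, hst⟩ := h.exists_vec_eq hkm hs
  exact hst ▸ vec_mem_space ht

theorem tendsto_starProjection (x : K) :
    Tendsto (fun k => ((c k).space π ξ).starProjection x) atTop
      (𝓝 ((limitSpace π ξ c).starProjection x)) :=
  have : (⨆ k, (c k).space π ξ).topologicalClosure.HasOrthogonalProjection :=
    inferInstanceAs (limitSpace π ξ c).HasOrthogonalProjection
  Submodule.starProjection_tendsto_closure_iSup _ h.monotone_space x

theorem compression_limitSpace_eq_zero {T : K →L[ℂ] K}
    (hT : ∀ k, ∀ x ∈ (c k).space π ξ, ∀ y ∈ (c k).space π ξ, ⟪y, T x⟫_ℂ = 0) :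
    compression (limitSpace π ξ c) T = 0 :=
  compression_eq_zero h.monotone_space hT

theorem compression_mul_of_mem_upper (hU : ∀ n, A.toSubmodule ⊓ M.level n = M.upper n) {n m : ℕ}
    {a b : 𝔄} (ha : a ∈ M.upper n) (hb : b ∈ M.upper m) :
    compression (limitSpace π ξ c) (π a) * compression (limitSpace π ξ c) (π b) =
      compression (limitSpace π ξ c) (π (a * b)) := by
  rw [← compression_comp_starProjection_comp, map_mul, ← sub_eq_zero, ← map_sub]
  refine h.compression_limitSpace_eq_zero fun j x hx y hy => ?_
  rw [sub_apply, inner_sub_right, sub_eq_zero]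
  refine tendsto_nhds_unique (Tendsto.inner tendsto_const_nhds
    (((π a).continuous.tendsto _).comp (h.tendsto_starProjection (π b x))))
    (tendsto_const_nhds.congr' ?_)
  filter_upwards [eventually_ge_atTop (max j (max n m))] with k hk
  simp only [max_le_iff] at hk
  exact (inner_apply_starProjection_apply (upper_mono hU (hk.2.1.trans (h.le_level k)) ha)
    (upper_mono hU (hk.2.2.trans (h.le_level k)) hb) (h.monotone_space hk.1 hx)
    (h.monotone_space hk.1 hy)).symm

theorem compression_mul (hA : IsTAF M A) (hU : ∀ n, A.toSubmodule ⊓ M.level n = M.upper n)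
    {a b : 𝔄} (ha : a ∈ A) (hb : b ∈ A) :
    compression (limitSpace π ξ c) (π a) * compression (limitSpace π ξ c) (π b) =
      compression (limitSpace π ξ c) (π (a * b)) := by
  have hcont : Continuous fun a => compression (limitSpace π ξ c) (π a) :=
    (compression _).continuous.comp (AddMonoidHomClass.continuous_of_bound π 1 fun a => by
      simpa only [one_mul] using NonUnitalStarAlgHom.norm_apply_le π a)
  have hleft : ∀ n, ∀ a ∈ M.upper n, ∀ b ∈ A, compression (limitSpace π ξ c) (π a) *
      compression (limitSpace π ξ c) (π b) = compression (limitSpace π ξ c) (π (a * b)) := by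
    intro n a ha b hb
    refine (isClosed_eq (continuous_const.clm_comp hcont) (hcont.comp
      (continuous_const_mul a))).closure_subset_iff.2 ?_ (subset_closure_iUnion_upper hA hU hb)
    exact Set.iUnion_subset fun m b hb => h.compression_mul_of_mem_upper hU ha hb
  refine (isClosed_eq (hcont.clm_comp continuous_const) (hcont.comp
    (continuous_mul_const b))).closure_subset_iff.2 ?_ (subset_closure_iUnion_upper hA hU ha)
  exact Set.iUnion_subset fun n a ha => hleft n a ha b hb

end IsLimitVector

end LimitSpace

section Nest

variable {𝔄 : Type*} [NonUnitalCStarAlgebra 𝔄] {M : AFSystem 𝔄} {A : NonUnitalSubalgebra ℂ 𝔄}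
  {K : Type*} [NormedAddCommGroup K] [InnerProductSpace ℂ K] [CompleteSpace K]
  {π : 𝔄 →⋆ₙₐ[ℂ] (K →L[ℂ] K)} {ξ : K}

theorem sum_inner_smul_vec {c : M.Cell} (hξ : ‖ξ‖ = 1) (hc : π c.proj ξ = ξ) {y : K}
    (hy : y ∈ c.space π ξ) :
    ∑ s ∈ Finset.Icc c.row c.col, ⟪c.vec π ξ s, y⟫_ℂ • c.vec π ξ s = y := by
  induction hy using Submodule.span_induction with
  | mem y hy =>
    obtain ⟨t, ht, rfl⟩ := hy
    rw [Finset.sum_eq_single_of_mem t (Finset.mem_Icc.2 ht) fun s _ hst => by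
      rw [inner_vec_of_ne hst, zero_smul], inner_vec_self hξ hc ht, one_smul]
  | zero => simp only [inner_zero_right, zero_smul, Finset.sum_const_zero]
  | add y z _ _ hy hz => simp only [inner_add_right, add_smul, Finset.sum_add_distrib, hy, hz]
  | smul a y _ hy => simp only [inner_smul_right, mul_smul, ← Finset.smul_sum, hy]

theorem inner_vec_starProjection {c : M.Cell} {s : M.Idx c.level} (hs : s ∈ Set.Icc c.row c.col)
    (x : K) : ⟪c.vec π ξ s, (c.space π ξ).starProjection x⟫_ℂ = ⟪c.vec π ξ s, x⟫_ℂ := by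
  rw [← Submodule.inner_starProjection_left_eq_right,
    Submodule.starProjection_eq_self_iff.2 (vec_mem_space hs)]

theorem vec_mem_limitSpace {c : ℕ → M.Cell} {k : ℕ} {s : M.Idx (c k).level}
    (hs : s ∈ Set.Icc (c k).row (c k).col) : (c k).vec π ξ s ∈ limitSpace π ξ c :=
  Submodule.le_topologicalClosure _ (Submodule.mem_iSup_of_mem k (vec_mem_space hs))

theorem vec_mem_of_vec_mem (hU : ∀ n, A.toSubmodule ⊓ M.level n = M.upper n)
    {c : ℕ → M.Cell} {N : Submodule ℂ K}
    (hinv : ∀ a ∈ A, ∀ x ∈ N, (limitSpace π ξ c).starProjection (π a x) ∈ N) {k : ℕ}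
    {s t : M.Idx (c k).level} (hs : s ∈ Set.Icc (c k).row (c k).col) (hst : s ≤ t)
    (ht : (c k).vec π ξ t ∈ N) : (c k).vec π ξ s ∈ N := by
  have hmem := hinv _ ((mem_upper_iff hU).1 (AFSystem.unit_mem_upper hst)).1 _ ht
  rwa [apply_unit_vec (fst_eq_of_le hst),
    Submodule.starProjection_eq_self_iff.2 (vec_mem_limitSpace hs)] at hmem

namespace IsLimitVector

variable {c : ℕ → M.Cell} (h : IsLimitVector π ξ c)
include h

theorem tendsto_starProjection_of_mem {x : K} (hx : x ∈ limitSpace π ξ c) :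
    Tendsto (fun k => ((c k).space π ξ).starProjection x) atTop (𝓝 x) := by
  simpa only [Submodule.starProjection_eq_self_iff.2 hx] using h.tendsto_starProjection x

theorem tendsto_apply_proj {k : ℕ} {s : M.Idx (c k).level} {t : ∀ j, M.Idx (c (k + j)).level}
    (ht : ∀ j, t j ∈ Set.Icc (c (k + j)).row (c (k + j)).col)
    (hst : ∀ j, (c k).vec π ξ s = (c (k + j)).vec π ξ (t j)) {x : K}
    (hx : x ∈ limitSpace π ξ c) :
    Tendsto (fun j => π (M.proj (c (k + j)).level (t j)) x) atTop
      (𝓝 (⟪(c k).vec π ξ s, x⟫_ℂ • (c k).vec π ξ s)) := by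
  have hlim : Tendsto (fun j => ‖x - ((c (k + j)).space π ξ).starProjection x‖) atTop (𝓝 0) := by
    have hx' := (h.tendsto_starProjection_of_mem hx).comp (tendsto_add_atTop_nat k)
    simpa only [sub_self, norm_zero, Function.comp_def, add_comm k] using
      ((tendsto_const_nhds (x := x)).sub hx').norm
  rw [tendsto_iff_norm_sub_tendsto_zero]
  refine squeeze_zero (fun _ => norm_nonneg _) (fun j => ?_) hlim
  rw [hst j, ← inner_vec_starProjection (ht j) x, ← apply_proj_of_mem_space h.norm_eq_one
    (h.apply_proj _) (ht j) (Submodule.starProjection_apply_mem _ x), ← map_sub]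
  refine ((π _).le_of_opNorm_le ((NonUnitalStarAlgHom.norm_apply_le π _).trans_eq
    (norm_unit rfl)) _).trans_eq (one_mul _)

variable {N N' : Submodule ℂ K}

/-- The projections of the cells at the position of `vec s` shrink to the rank-one projection
onto `vec s`. -/
theorem vec_mem_of_inner_ne_zero (hU : ∀ n, A.toSubmodule ⊓ M.level n = M.upper n)
    (hN : IsClosed (N : Set K)) (hNL : N ≤ limitSpace π ξ c)
    (hinv : ∀ a ∈ A, ∀ x ∈ N, (limitSpace π ξ c).starProjection (π a x) ∈ N) {x : K} (hx : x ∈ N)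
    {k : ℕ} {s : M.Idx (c k).level} (hs : s ∈ Set.Icc (c k).row (c k).col)
    (hsx : ⟪(c k).vec π ξ s, x⟫_ℂ ≠ 0) : (c k).vec π ξ s ∈ N := by
  choose t ht hst using fun j => h.exists_vec_eq (Nat.le_add_right k j) hs
  have hlim := ((limitSpace π ξ c).starProjection.continuous.tendsto _).comp
    (h.tendsto_apply_proj ht hst (hNL hx))
  rw [map_smul, Submodule.starProjection_eq_self_iff.2 (vec_mem_limitSpace hs)] at hlim
  refine (N.smul_mem_iff hsx).1 (hN.mem_of_tendsto hlim (Eventually.of_forall fun j => ?_))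
  exact hinv _ (proj_mem hU _) x hx

theorem exists_vec_not_mem (hU : ∀ n, A.toSubmodule ⊓ M.level n = M.upper n)
    (hN : IsClosed (N : Set K)) (hNL : N ≤ limitSpace π ξ c)
    (hinv : ∀ a ∈ A, ∀ x ∈ N, (limitSpace π ξ c).starProjection (π a x) ∈ N)
    (hN' : IsClosed (N' : Set K)) (hle : ¬N ≤ N') :
    ∃ k, ∃ s ∈ Set.Icc (c k).row (c k).col, (c k).vec π ξ s ∈ N ∧ (c k).vec π ξ s ∉ N' := by
  by_contra! hvec
  refine hle fun x hx => hN'.mem_of_tendsto (h.tendsto_starProjection_of_mem (hNL hx))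
    (Eventually.of_forall fun k => ?_)
  have hsum := sum_inner_smul_vec h.norm_eq_one (h.apply_proj k)
    (Submodule.starProjection_apply_mem ((c k).space π ξ) x)
  refine SetLike.mem_coe.2 (hsum ▸ N'.sum_mem fun s hs => ?_)
  have hs' := Finset.mem_Icc.1 hs
  rw [inner_vec_starProjection hs']
  by_cases hsx : ⟪(c k).vec π ξ s, x⟫_ℂ = 0
  · rw [hsx, zero_smul]
    exact zero_mem _
  · exact N'.smul_mem _ (hvec k s hs' (h.vec_mem_of_inner_ne_zero hU hN hNL hinv hx hs' hsx))

theorem le_total_of_invariant (hU : ∀ n, A.toSubmodule ⊓ M.level n = M.upper n)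
    (hN : IsClosed (N : Set K)) (hNL : N ≤ limitSpace π ξ c)
    (hinv : ∀ a ∈ A, ∀ x ∈ N, (limitSpace π ξ c).starProjection (π a x) ∈ N)
    (hN' : IsClosed (N' : Set K)) (hNL' : N' ≤ limitSpace π ξ c)
    (hinv' : ∀ a ∈ A, ∀ x ∈ N', (limitSpace π ξ c).starProjection (π a x) ∈ N') :
    N ≤ N' ∨ N' ≤ N := by
  by_contra! hle
  obtain ⟨k, s, hs, hsN, hsN'⟩ := h.exists_vec_not_mem hU hN hNL hinv hN' hle.1
  obtain ⟨j, t, ht, htN', htN⟩ := h.exists_vec_not_mem hU hN' hNL' hinv' hN hle.2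
  obtain ⟨u, hu, hsu⟩ := h.exists_vec_eq (le_max_left k j) hs
  obtain ⟨v, hv, htv⟩ := h.exists_vec_eq (le_max_right k j) ht
  rw [hsu] at hsN hsN'
  rw [htv] at htN htN'
  rcases le_total_of_fst_eq ((fst_eq_pos_of_mem_Icc hu).trans (fst_eq_pos_of_mem_Icc hv).symm) with
    huv | hvu
  · exact hsN' (vec_mem_of_vec_mem hU hinv' hu huv htN')
  · exact htN (vec_mem_of_vec_mem hU hinv hv hvu hsN)

end IsLimitVector

end Nest

section Rep

variable {𝔄 : Type*} [NonUnitalCStarAlgebra 𝔄] {M : AFSystem 𝔄} {A : NonUnitalSubalgebra ℂ 𝔄}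
  {K : Type*} [NormedAddCommGroup K] [InnerProductSpace ℂ K] [CompleteSpace K]
  {π : 𝔄 →⋆ₙₐ[ℂ] (K →L[ℂ] K)} {ξ : K} {c : ℕ → M.Cell}

instance : TopologicalSpace.SeparableSpace (limitSpace π ξ c) := by
  have hsep : TopologicalSpace.IsSeparable (⋃ k, (c k).vec π ξ '' Set.Icc (c k).row (c k).col) :=
    TopologicalSpace.IsSeparable.iUnion fun k => (Set.toFinite _).isSeparable
  have hspan : ⨆ k, (c k).space π ξ =
      Submodule.span ℂ (⋃ k, (c k).vec π ξ '' Set.Icc (c k).row (c k).col) :=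
    (Submodule.span_iUnion _).symm
  refine TopologicalSpace.IsSeparable.separableSpace (?_ : TopologicalSpace.IsSeparable _)
  rw [limitSpace, Submodule.topologicalClosure_coe, hspan]
  exact hsep.span.closure

namespace IsLimitVector

variable (h : IsLimitVector π ξ c)
include h

/-- The compression of `π` to the limit space, a representation of `A`. -/
noncomputable def rep (hA : IsTAF M A) (hU : ∀ n, A.toSubmodule ⊓ M.level n = M.upper n) :
    A →ₙₐ[ℂ] (limitSpace π ξ c →L[ℂ] limitSpace π ξ c) where
  toFun a := compression (limitSpace π ξ c) (π a)
  map_smul' z a := by simp only [NonUnitalSubalgebra.coe_smul, map_smul, MonoidHom.id_apply]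
  map_zero' := by simp only [ZeroMemClass.coe_zero, map_zero]
  map_add' a b := by simp only [NonUnitalSubalgebra.coe_add, map_add]
  map_mul' a b := (h.compression_mul hA hU a.2 b.2).symm

theorem rep_apply (hA : IsTAF M A) (hU : ∀ n, A.toSubmodule ⊓ M.level n = M.upper n) (a : A) :
    h.rep hA hU a = compression (limitSpace π ξ c) (π a) :=
  rfl

theorem isBoundedNestRep_rep (hA : IsTAF M A)
    (hU : ∀ n, A.toSubmodule ⊓ M.level n = M.upper n) : IsBoundedNestRep (h.rep hA hU) where
  bounded := ⟨1, fun a => by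
    rw [one_mul]
    exact (norm_compression_le _ _).trans (NonUnitalStarAlgHom.norm_apply_le π (a : 𝔄))⟩
  nest N N' hN hN' hinv hinv' := by
    have hclosed : ∀ {N : Submodule ℂ (limitSpace π ξ c)}, IsClosed (N : Set (limitSpace π ξ c)) →
        IsClosed (N.map (limitSpace π ξ c).subtype : Set K) := fun hN =>
      (Submodule.isClosed_topologicalClosure _).isClosedEmbedding_subtypeVal.isClosedMap _ hN
    have hinvariant : ∀ {N : Submodule ℂ (limitSpace π ξ c)},
        (∀ a : A, ∀ x ∈ N, h.rep hA hU a x ∈ N) →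
        ∀ a ∈ A, ∀ x ∈ N.map (limitSpace π ξ c).subtype,
          (limitSpace π ξ c).starProjection (π a x) ∈ N.map (limitSpace π ξ c).subtype := by
      rintro N hN a ha _ ⟨x, hx, rfl⟩
      exact ⟨h.rep hA hU ⟨a, ha⟩ x, hN ⟨a, ha⟩ x hx, rfl⟩
    have hle := h.le_total_of_invariant hU (hclosed hN) (Submodule.map_subtype_le _ _)
      (hinvariant hinv) (hclosed hN') (Submodule.map_subtype_le _ _) (hinvariant hinv')
    simpa only [Submodule.map_le_map_iff_of_injective (Submodule.subtype_injective _)] using hle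

theorem compression_unit_ne_zero (k : ℕ) :
    compression (limitSpace π ξ c) (π (c k).unit) ≠ 0 := by
  intro hzero
  have hle := (c k).row_le_pos.trans (c k).pos_le_col
  have hrow : (c k).row ∈ Set.Icc (c k).row (c k).col := ⟨le_rfl, hle⟩
  have hcol : (c k).col ∈ Set.Icc (c k).row (c k).col := ⟨hle, le_rfl⟩
  have hinner := inner_compression_apply (limitSpace π ξ c) (π (c k).unit)
    ⟨_, vec_mem_limitSpace hcol⟩ ⟨_, vec_mem_limitSpace hrow⟩
  rw [hzero, zero_apply, inner_zero_right, Cell.unit, apply_unit_vec (fst_eq_of_le hle),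
    inner_vec_self h.norm_eq_one (h.apply_proj k) hrow] at hinner
  exact zero_ne_one hinner

theorem compression_eq_zero_of_mem (hU : ∀ n, A.toSubmodule ⊓ M.level n = M.upper n)
    {J : Submodule ℂ 𝔄} (hJ : IsClosedIdeal A J) (hcJ : ∀ k, (c k).unit ∉ J) {n : ℕ} {a : 𝔄}
    (ha : a ∈ J) (hal : a ∈ M.level n) : compression (limitSpace π ξ c) (π a) = 0 := by
  refine h.compression_limitSpace_eq_zero fun k x hx y hy => ?_
  exact inner_apply_eq_zero_of_mem hU hJ (hcJ (max k n)) ha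
    (level_mono ((le_max_right k n).trans (h.le_level _)) hal)
    (h.monotone_space (le_max_left k n) hx) (h.monotone_space (le_max_left k n) hy)

theorem ker_rep (hA : IsTAF M A) (hU : ∀ n, A.toSubmodule ⊓ M.level n = M.upper n)
    {J : Submodule ℂ 𝔄} (hJ : IsClosedIdeal A J) (hcJ : ∀ k, (c k).unit ∉ J)
    (hdom : ∀ f : M.Cell, f.unit ∉ J → ∃ k, ∃ a ∈ A, ∃ b ∈ A, a * f.unit * b = (c k).unit) :
    TwoSidedIdeal.ker (h.rep hA hU) = hJ.toTwoSidedIdeal := by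
  obtain ⟨I, hI, hIker⟩ :=
    IsClosedIdeal.exists_toTwoSidedIdeal_eq hA hU (h.isBoundedNestRep_rep hA hU).isClosed_ker
  have hmem : ∀ {a : 𝔄} (_ : a ∈ A), a ∈ I ↔ compression (limitSpace π ξ c) (π a) = 0 :=
    fun {a} ha => by
      rw [← h.rep_apply hA hU ⟨a, ha⟩, ← TwoSidedIdeal.mem_ker, ← hIker, hI.mem_toTwoSidedIdeal]
  rw [← hIker, IsClosedIdeal.toTwoSidedIdeal_inj]
  refine le_antisymm (le_of_unit_mem hA hU hI hJ.isClosed fun n x y hx => ?_)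
    (le_of_unit_mem hA hU hJ hI.isClosed fun n x y hx => (hmem (hJ.le hx)).2
      (h.compression_eq_zero_of_mem hU hJ hcJ hx (unit_mem_level x y)))
  by_contra hxJ
  have hfst : x.1 = y.1 := unit_ne_zero_iff.1 fun h0 => hxJ (h0 ▸ J.zero_mem)
  have hxy : x ≤ y :=
    le_of_unit_mem_upper hfst ((mem_upper_iff hU).2 ⟨hI.le hx, unit_mem_level x y⟩)
  obtain ⟨k, a, ha, b, hb, hab⟩ := hdom ⟨n, x, y, x, le_rfl, hxy⟩ hxJ
  have hunit : (c k).unit ∈ I :=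
    hab ▸ hI.mul_mem_right b hb _ (hI.mul_mem_left a ha _ hx)
  exact h.compression_unit_ne_zero k ((hmem (hI.le hunit)).1 hunit)

end IsLimitVector

end Rep

end Cell

end AFSystem

section SeparableHilbert

variable {E : Type*} [NormedAddCommGroup E] [InnerProductSpace ℂ E]
  [TopologicalSpace.SeparableSpace E]

theorem countable_of_orthonormal {ι : Type*} {b : ι → E} (hb : Orthonormal ℂ b) :
    Countable ι := by
  refine Pairwise.countable_of_isOpen_disjoint (s := fun i => Metric.ball (b i) (1 / 2))
    (fun i j hij => Metric.ball_disjoint_ball ?_) (fun _ => Metric.isOpen_ball)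
    fun i => Metric.nonempty_ball.2 one_half_pos
  have hsq : dist (b i) (b j) * dist (b i) (b j) = 2 := by
    rw [dist_eq_norm, norm_sub_mul_self (𝕜 := ℂ), hb.inner_eq_zero hij, hb.norm_eq_one,
      hb.norm_eq_one]
    norm_num
  nlinarith [dist_nonneg (x := b i) (y := b j)]

variable (E) in
theorem exists_linearIsometryEquiv_lp [CompleteSpace E] :
    ∃ ι : Type v, Nonempty (E ≃ₗᵢ[ℂ] lp (fun _ : ι => ℂ) 2) := by
  obtain ⟨w, b, -⟩ := exists_hilbertBasis ℂ E
  have : Countable w := countable_of_orthonormal b.orthonormal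
  let φ := equivShrink.{v} w
  refine ⟨Shrink.{v} w, ⟨(HilbertBasis.mk (b.orthonormal.comp φ.symm φ.symm.injective) ?_).repr⟩⟩
  rw [φ.symm.surjective.range_comp, b.dense_span]

end SeparableHilbert

section Conjugation

variable {𝔄 : Type*} [NonUnitalCStarAlgebra 𝔄] {A : NonUnitalSubalgebra ℂ 𝔄}
  {H H' : Type*} [NormedAddCommGroup H] [InnerProductSpace ℂ H] [NormedAddCommGroup H']
  [InnerProductSpace ℂ H']

/-- The representation on `H'` obtained from a representation on `H` by conjugation with an
isomorphism. -/
noncomputable def conjRep (e : H ≃L[ℂ] H') (π : A →ₙₐ[ℂ] (H →L[ℂ] H)) :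
    A →ₙₐ[ℂ] (H' →L[ℂ] H') :=
  NonUnitalAlgHom.comp (e.conjContinuousAlgEquiv : (H →L[ℂ] H) →ₙₐ[ℂ] (H' →L[ℂ] H')) π

theorem conjRep_apply (e : H ≃L[ℂ] H') (π : A →ₙₐ[ℂ] (H →L[ℂ] H)) (a : A) :
    conjRep e π a = e.conjContinuousAlgEquiv (π a) :=
  rfl

theorem ker_conjRep (e : H ≃L[ℂ] H') (π : A →ₙₐ[ℂ] (H →L[ℂ] H)) :
    TwoSidedIdeal.ker (conjRep e π) = TwoSidedIdeal.ker π := by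
  ext a
  rw [TwoSidedIdeal.mem_ker, TwoSidedIdeal.mem_ker, conjRep_apply, EmbeddingLike.map_eq_zero_iff]

variable {π : A →ₙₐ[ℂ] (H →L[ℂ] H)}

theorem isBoundedNestRep_conjRep (hπ : IsBoundedNestRep π) (e : H ≃L[ℂ] H') :
    IsBoundedNestRep (conjRep e π) where
  bounded := by
    obtain ⟨C, hC⟩ := hπ.bounded
    let Φ : (H →L[ℂ] H) →L[ℂ] (H' →L[ℂ] H') := e.arrowCongr e
    refine ⟨‖Φ‖ * C, fun a => ?_⟩
    calc ‖Φ (π a)‖ ≤ ‖Φ‖ * ‖π a‖ := Φ.le_opNorm _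
      _ ≤ ‖Φ‖ * (C * ‖(a : 𝔄)‖) := by gcongr; exact hC a
      _ = ‖Φ‖ * C * ‖(a : 𝔄)‖ := (mul_assoc _ _ _).symm
  nest N N' hN hN' hinv hinv' := by
    have hinvariant : ∀ {N : Submodule ℂ H'}, (∀ a, ∀ x ∈ N, conjRep e π a x ∈ N) →
        ∀ a, ∀ x ∈ N.comap (e : H →ₗ[ℂ] H'), π a x ∈ N.comap (e : H →ₗ[ℂ] H') :=
      fun {N} hN a x hx => by
        have hmem : e (π a (e.symm (e x))) ∈ N := hN a (e x) hx
        rwa [e.symm_apply_apply] at hmem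
    have hle := hπ.nest _ _ (hN.preimage e.continuous) (hN'.preimage e.continuous)
      (hinvariant hinv) (hinvariant hinv')
    simpa only [Submodule.comap_le_comap_iff_of_surjective e.surjective] using hle

theorem IsBoundedNestRep.isNPrimitive_ker [CompleteSpace H] [TopologicalSpace.SeparableSpace H]
    (hπ : IsBoundedNestRep π) : IsNPrimitive.{v} (TwoSidedIdeal.ker π) := by
  obtain ⟨ι, ⟨e⟩⟩ := exists_linearIsometryEquiv_lp.{v} H
  exact ⟨_, _, _, inferInstance, _,
    isBoundedNestRep_conjRep hπ e.toContinuousLinearEquiv, ker_conjRep _ π⟩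

end Conjugation

section NPrimitive

theorem isNPrimitive_top {𝔄 : Type*} [NonUnitalCStarAlgebra 𝔄] (A : NonUnitalSubalgebra ℂ 𝔄) :
    IsNPrimitive.{v} (⊤ : TwoSidedIdeal A) := by
  refine ⟨PUnit.{v + 1}, inferInstance, inferInstance, inferInstance, 0, ⟨⟨0, fun a => ?_⟩,
    fun K L _ _ _ _ => Or.inl (Subsingleton.elim K L).le⟩, top_le_iff.1 fun a _ => ?_⟩
  · rw [NonUnitalAlgHom.zero_apply, norm_zero, zero_mul]
  · exact (TwoSidedIdeal.mem_ker _).2 rfl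

variable {𝔄 : Type*} [NonUnitalCStarAlgebra 𝔄] {M : AFSystem 𝔄} {A : NonUnitalSubalgebra ℂ 𝔄}

theorem IsClosedIdeal.toTwoSidedIdeal_eq_top (hA : IsTAF M A)
    (hU : ∀ n, A.toSubmodule ⊓ M.level n = M.upper n) {I : Submodule ℂ 𝔄}
    (hI : IsClosedIdeal A I) (hunit : ∀ c : M.Cell, c.unit ∈ I) : hI.toTwoSidedIdeal = ⊤ := by
  have hupper : ⋃ n, (M.upper n : Set 𝔄) ⊆ I := Set.iUnion_subset fun n => by
    rw [AFSystem.upper_eq_span]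
    refine Submodule.span_le.2 ?_
    rintro _ ⟨x, y, hxy, rfl⟩
    exact hunit ⟨n, x, y, x, le_rfl, hxy⟩
  exact top_le_iff.1 fun a _ => hI.mem_toTwoSidedIdeal.2
    (hI.isClosed.closure_subset_iff.2 hupper (AFSystem.subset_closure_iUnion_upper hA hU a.2))

theorem IsMeetIrreducible.isNPrimitive (hA : IsStronglyMaximalTAF A) {J : TwoSidedIdeal A}
    (hJ : IsMeetIrreducible J) : IsNPrimitive.{v} J := by
  obtain ⟨M, hM, hU⟩ := hA
  obtain ⟨I, hI, rfl⟩ := IsClosedIdeal.exists_toTwoSidedIdeal_eq hM hU hJ.1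
  by_cases hne : ∃ c : M.Cell, c.unit ∉ I
  · have hirr := (IsClosedIdeal.isMeetIrreducible_toTwoSidedIdeal_iff hM hU hI).1 hJ
    obtain ⟨c, hcI, hlevel, hc, hdom⟩ := AFSystem.Cell.exists_seq hM hU hI hirr hne
    obtain ⟨K, _, _, _, π, ξ, hξ, hproj⟩ := AFSystem.Cell.exists_rep_fixed_vector hlevel hc
    have h : AFSystem.Cell.IsLimitVector π ξ c := ⟨hξ, hproj, hc, hlevel⟩
    exact h.ker_rep hM hU hI hcI hdom ▸ (h.isBoundedNestRep_rep hM hU).isNPrimitive_ker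
  · push Not at hne
    exact hI.toTwoSidedIdeal_eq_top hM hU hne ▸ isNPrimitive_top A

end NPrimitive

theorem theorem2p6_general {𝔄 : Type u} [NonUnitalCStarAlgebra 𝔄] (A : NonUnitalSubalgebra ℂ 𝔄)
    (hA : IsStronglyMaximalTAF A) :
    (∀ (H : Type v) [NormedAddCommGroup H] [InnerProductSpace ℂ H] (π : A →ₙₐ[ℂ] (H →L[ℂ] H)),
      IsBoundedNestRep π → IsMeetIrreducible (TwoSidedIdeal.ker π)) ∧
    (∀ J : TwoSidedIdeal A, IsNPrimitive.{v} J ↔ IsMeetIrreducible J) := by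
  refine ⟨fun H _ _ π hπ => hπ.isMeetIrreducible_ker hA, fun J => ⟨?_, fun hJ =>
    hJ.isNPrimitive hA⟩⟩
  rintro ⟨H, _, _, _, π, hπ, rfl⟩
  exact hπ.isMeetIrreducible_ker hA

theorem theorem2p6 {𝔄 : Type u} [NonUnitalCStarAlgebra 𝔄] (A : NonUnitalSubalgebra ℂ 𝔄)
    (hA : IsStronglyMaximalTAF A) :
    (∀ (H : Type v) [NormedAddCommGroup H] [InnerProductSpace ℂ H] [CompleteSpace H]
      (π : A →ₙₐ[ℂ] (H →L[ℂ] H)), IsBoundedNestRep π →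
        IsMeetIrreducible (TwoSidedIdeal.ker π)) ∧
    (∀ J : TwoSidedIdeal A, IsNPrimitive.{v} J ↔ IsMeetIrreducible J) :=
  ⟨fun H _ _ _ => (theorem2p6_general A hA).1 H, (theorem2p6_general A hA).2⟩
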